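/- Let $n\ge 0$ and $T>0$, and let $|\cdot|$, $\langle\cdot,\cdot\rangle$ be the Euclidean norm and inner product. Let $X$ be a linear space of functions $x:[0,T]\to\mathbb R^n$ with $C^\infty([0,T];\mathbb R^n)\subset X\subset AC([0,T];\mathbb R^n)$, normed by $\|x\|_{ac}=|x(0)|+\int_0^T|\dot x(t)|\,dt$. Let $\varphi:\mathbb R^n\times\mathbb R^n\to\mathbb R$, $\vartheta:[0,T]\times\mathbb R^n\times\mathbb R^n\to\mathbb R$, $g:[0,T]\times\mathbb R^n\to\mathbb R^n$, $\Omega_1\subset\mathbb R^n$, $\Omega_2\subset\mathbb R^n\times\mathbb R^n$. The extended Bolza problem is to minimize $$J(x)=\varphi(x(0),x(T))+\int_0^T\vartheta(t,x(t),\dot x(t))\,dt,\qquad x\in X,$$ subject to $\dot x(t)+g(t,x(t))\in\Omega_1$ for a.e. $t\in[0,T]$ and $(x(0),x(T))\in\Omega_2$. Let $\mathcal S$ be the set of all $x\in X$ that satisfy these constraints and for which $J(x)$ is finite (the integrand is integrable). A curve $\bar x\in\mathcal S$ is an $X$-strong local minimizer if for some $\varepsilon>0$ we have $J(\bar x)\le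 J(x)$ for all $x\in\mathcal S$ with $\|x-\bar x\|_{ac}<\varepsilon$. **Theorem 3.1.** Let $\bar x$ be an $X$-strong local minimizer, and assume: - (H1) $\varphi$ is continuously differentiable around $(\bar x(0),\bar x(T))$. - (H2) $t\mapsto\vartheta(t,x,v)$ is measurable on $[0,T]$ for all $(x,v)$; for a.e. $t\in[0,T]$, $\vartheta(t,\cdot,\cdot)$ is continuously differentiable around $(\bar x(t),\dot{\bar x}(t))$; and there are $\varepsilon>0$ and $\ell$ such that for all $x_1,x_2\in X$ with $\|x_i-\bar x\|_{ac}\le\varepsilon$ the functions $t\mapsto\vartheta(t,x_i(t),\dot x_i(t))$ are measurable on $[0,T]$ and $$|\vartheta(t,x_1(t),\dot x_1(t))-\vartheta(t,x_2(t),\dot x_2(t))|\le\ell\big(|x_1(t)-x_2(t)|+|\dot x_1(t)-\dot x_2(t)|\big)\quad\text{for a.e. }t\in[0,T].$$ - (H3) $\Omega_1$ and $\Omega_2$ are convex; for a.e. $t\in[0,T]$ there is a closed ball of positive radius centered at $\dot{\bar x}(t)+g(t,\bar x(t))$ whose intersection with $\Omega_1$ is closed, and there is a closed ball of positive radius centered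 at $(\bar x(0),\bar x(T))$ whose intersection with $\Omega_2$ is closed. - (H4) $g(t,\cdot)$ is continuously differentiable for a.e. $t\in[0,T]$; $g(\cdot,x)$ and $\nabla_xg(\cdot,x)$ are measurable on $[0,T]$ for every $x$; and there is $\varepsilon>0$ such that for every measurable $x:[0,T]\to\mathbb R^n$ with $|x(t)-\bar x(t)|\le\varepsilon$ for a.e. $t$, the functions $t\mapsto g(t,x(t))$ and $t\mapsto\nabla_xg(t,x(t))$ are essentially bounded on $[0,T]$. - (H5) There are $\kappa>0$ and $\delta>0$ such that for all $x\in X$ with $\|x-\bar x\|_{ac}<\delta$ $$\inf_{u\in\mathcal S}\|x-u\|_{ac}\le\kappa\int_0^T\mathrm{dist}\big(\dot x(t)+g(t,x(t));\Omega_1\big)\,dt+\kappa\,\mathrm{dist}\big((x(0),x(T));\Omega_2\big).$$ Then there is $p\in AC([0,T];\mathbb R^n)$ such that, for a.e. $t\in[0,T]$, the Euler–Lagrange equation $$\dot p(t)-\nabla_xg(t,\bar x(t))^*p(t)=\nabla_x\vartheta(t,\bar x(t),\dot{\bar x}(t))-\nabla_xg(t,\bar x(t))^*\nabla_v\vartheta(t,\bar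 x(t),\dot{\bar x}(t))$$ holds; for a.e. $t\in[0,T]$, the Weierstrass–Pontryagin maximization condition $$\big\langle p(t)-\nabla_v\vartheta(t,\bar x(t),\dot{\bar x}(t)),\,\dot{\bar x}(t)+g(t,\bar x(t))\big\rangle=\max_{w\in\Omega_1}\big\langle p(t)-\nabla_v\vartheta(t,\bar x(t),\dot{\bar x}(t)),\,w\big\rangle$$ holds; and the transversality inclusion $$(p(0),-p(T))\in\nabla\varphi(\bar x(0),\bar x(T))+N_{\Omega_2}(\bar x(0),\bar x(T))$$ holds, where $N_\Omega(a)=\{v\mid\langle v,w-a\rangle\le0\text{ for all }w\in\Omega\}$ for $a\in\Omega$ is the normal cone of convex analysis. -/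

import Mathlib

open MeasureTheory Set
open scoped Pointwise ContDiff Gradient

noncomputable section

namespace ExtBolza

/-- The Euclidean space of states and velocities. -/
abbrev E (n : ℕ) := EuclideanSpace ℝ (Fin n)

/-- The space of pairs of endpoints, with its Euclidean structure. -/
abbrev EP (n : ℕ) := WithLp 2 (E n × E n)

/-- Lebesgue measure on `[0, T]`. -/
abbrev leb (T : ℝ) : Measure ℝ := volume.restrict (Icc 0 T)

/-- The pair of endpoints `(x(0), x(T))` of a curve. -/
def endpoints {n : ℕ} (T : ℝ) (x : ℝ → E n) : EP n := WithLp.toLp 2 (x 0, x T)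

/-- The norm `‖x(0)‖ + ∫₀ᵀ ‖ẋ(t)‖ dt`. Curves are functions on `ℝ` of which only the
restriction to `[0, T]` matters. -/
def acNorm {n : ℕ} (T : ℝ) (x : ℝ → E n) : ℝ := ‖x 0‖ + ∫ t in (0 : ℝ)..T, ‖deriv x t‖

/-- The distance from a curve to a set of curves in the norm `acNorm`. -/
def acDist {n : ℕ} (T : ℝ) (x : ℝ → E n) (A : Set (ℝ → E n)) : ℝ :=
  sInf ((fun u => acNorm T (x - u)) '' A)

/-- The normal cone of convex analysis, empty at points outside of the set. -/
def normalCone {H : Type*} [NormedAddCommGroup H] [InnerProductSpace ℝ H]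
    (Ω : Set H) (a : H) : Set H :=
  {v | a ∈ Ω ∧ ∀ w ∈ Ω, inner ℝ v (w - a) ≤ 0}

/-- The data of the problem: minimize `φ(x(0), x(T)) + ∫₀ᵀ ϑ(t, x, ẋ) dt` over `x ∈ X` subject to
`ẋ + g(t, x) ∈ Ω₁` a.e. and `(x(0), x(T)) ∈ Ω₂`. The space `X` is a linear space of curves,
normed by `acNorm`, between `C^∞([0, T])` and `AC([0, T])`. As `X` contains every function on `ℝ`
that is smooth on `[0, T]`, it contains those that vanish on `[0, T]`; so membership in `X`
depends on the restriction to `[0, T]` only. -/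
structure Problem (n : ℕ) where
  T : ℝ
  T_pos : 0 < T
  X : Submodule ℝ (ℝ → E n)
  mem_of_smooth : ∀ x : ℝ → E n, ContDiffOn ℝ ∞ x (Icc 0 T) → x ∈ X
  ac_of_mem : ∀ x ∈ X, AbsolutelyContinuousOnInterval x 0 T
  φ : EP n → ℝ
  ϑ : ℝ → E n → E n → ℝ
  g : ℝ → E n → E n
  Ω₁ : Set (E n)
  Ω₂ : Set (EP n)

namespace Problem

variable {n : ℕ} (P : Problem n)

/-- The cost functional. -/
def J (x : ℝ → E n) : ℝ :=
  P.φ (endpoints P.T x) + ∫ t in (0 : ℝ)..P.T, P.ϑ t (x t) (deriv x t)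

/-- The set of feasible solutions: the constraints hold and the cost is finite. -/
def feasible : Set (ℝ → E n) :=
  {x | x ∈ P.X ∧
    (∀ᵐ t ∂leb P.T, deriv x t + P.g t (x t) ∈ P.Ω₁) ∧
    endpoints P.T x ∈ P.Ω₂ ∧
    IntervalIntegrable (fun t => P.ϑ t (x t) (deriv x t)) volume 0 P.T}

/-- `X`-strong local minimizers. -/
def IsStrongLocalMin (z : ℝ → E n) : Prop :=
  z ∈ P.feasible ∧
    ∃ ε > 0, ∀ x ∈ P.feasible, acNorm P.T (x - z) < ε → P.J z ≤ P.J x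

/-- The terminal cost is continuously differentiable around the endpoints of `z`. -/
def H1 (z : ℝ → E n) : Prop := ContDiffAt ℝ 1 P.φ (endpoints P.T z)

/-- The running cost is measurable in `t` (for fixed `(x, v)`, and along the curves near
`z`), continuously differentiable in `(x, v)` around `(z(t), ż(t))` for a.e. `t`, and Lipschitz
along the curves of `X` near `z`. -/
def H2 (z : ℝ → E n) : Prop :=
  (∀ x v, AEMeasurable (fun t => P.ϑ t x v) (leb P.T)) ∧
  (∀ᵐ t ∂leb P.T, ContDiffAt ℝ 1 (fun y : E n × E n => P.ϑ t y.1 y.2) (z t, deriv z t)) ∧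
  ∃ ε > 0,
    (∀ x ∈ P.X, acNorm P.T (x - z) ≤ ε →
      AEMeasurable (fun t => P.ϑ t (x t) (deriv x t)) (leb P.T)) ∧
    ∃ L : ℝ, ∀ x ∈ P.X, ∀ y ∈ P.X, acNorm P.T (x - z) ≤ ε → acNorm P.T (y - z) ≤ ε →
      ∀ᵐ t ∂leb P.T, |P.ϑ t (x t) (deriv x t) - P.ϑ t (y t) (deriv y t)| ≤
        L * (‖x t - y t‖ + ‖deriv x t - deriv y t‖)

/-- The constraint sets are convex, and locally closed around
`ż(t) + g(t, z(t))` for a.e. `t`, respectively around the endpoints of `z`. -/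
def H3 (z : ℝ → E n) : Prop :=
  Convex ℝ P.Ω₁ ∧ Convex ℝ P.Ω₂ ∧
  (∀ᵐ t ∂leb P.T, ∃ r > 0,
    IsClosed (P.Ω₁ ∩ Metric.closedBall (deriv z t + P.g t (z t)) r)) ∧
  ∃ r > 0, IsClosed (P.Ω₂ ∩ Metric.closedBall (endpoints P.T z) r)

/-- `g(t, x)` is continuously differentiable in `x` and measurable in `t` together with its
derivative in `x`; both are essentially bounded along all measurable curves that
are uniformly close to `z`. -/
def H4 (z : ℝ → E n) : Prop :=
  (∀ᵐ t ∂leb P.T, ContDiff ℝ 1 (P.g t)) ∧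
  (∀ x, AEStronglyMeasurable (fun t => P.g t x) (leb P.T)) ∧
  (∀ x, AEStronglyMeasurable (fun t => fderiv ℝ (P.g t) x) (leb P.T)) ∧
  ∃ ε > 0, ∀ x : ℝ → E n, AEStronglyMeasurable x (leb P.T) →
    (∀ᵐ t ∂leb P.T, ‖x t - z t‖ ≤ ε) →
      MemLp (fun t => P.g t (x t)) ⊤ (leb P.T) ∧
      MemLp (fun t => fderiv ℝ (P.g t) (x t)) ⊤ (leb P.T)

/-- The metric subregularity constraint qualification. -/
def H5 (z : ℝ → E n) : Prop :=
  ∃ κ > 0, ∃ δ > 0, ∀ x ∈ P.X, acNorm P.T (x - z) < δ →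
    acDist P.T x P.feasible ≤
      κ * (∫ t in (0 : ℝ)..P.T, Metric.infDist (deriv x t + P.g t (x t)) P.Ω₁) +
      κ * Metric.infDist (endpoints P.T x) P.Ω₂

/-- `∇ₓϑ(t, x(t), ẋ(t))`. -/
def gradX (x : ℝ → E n) (t : ℝ) : E n := ∇ (fun a => P.ϑ t a (deriv x t)) (x t)

/-- `∇ᵥϑ(t, x(t), ẋ(t))`. -/
def gradV (x : ℝ → E n) (t : ℝ) : E n := ∇ (fun v => P.ϑ t (x t) v) (deriv x t)

/-- The adjoint operator `∇ₓg(t, x(t))*`. -/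
def adjG (x : ℝ → E n) (t : ℝ) : E n →L[ℝ] E n :=
  ContinuousLinearMap.adjoint (fderiv ℝ (P.g t) (x t))

/-- The Euler–Lagrange equation. -/
def EulerLagrange (z p : ℝ → E n) : Prop :=
  ∀ᵐ t ∂leb P.T,
    deriv p t - P.adjG z t (p t) = P.gradX z t - P.adjG z t (P.gradV z t)

/-- The Weierstrass–Pontryagin maximization condition: the maximum over `Ω₁` is attained at
`ż(t) + g(t, z(t))`. -/
def Maximization (z p : ℝ → E n) : Prop :=
  ∀ᵐ t ∂leb P.T,
    IsGreatest ((fun w => inner ℝ (p t - P.gradV z t) w) '' P.Ω₁)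
      (inner ℝ (p t - P.gradV z t) (deriv z t + P.g t (z t)))

/-- The transversality inclusion. -/
def Transversality (z p : ℝ → E n) : Prop :=
  (WithLp.toLp 2 (p 0, -p P.T) : EP n) ∈
    ({∇ P.φ (endpoints P.T z)} : Set (EP n)) + normalCone P.Ω₂ (endpoints P.T z)

end Problem

end ExtBolza

end

/-!
The multiplier `p` comes from exact penalization and the Hahn–Banach theorem.

The cost is Lipschitz in the norm of absolutely continuous curves, and by metric subregularity the
distance from the feasible set is at most a multiple of the constraint violation. Hence `z`
minimizes locally, over all of `X`, the cost plus a multiple of `∫ dist(ẋ + g(t, x); Ω₁) dt` and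
`dist((x(0), x(T)); Ω₂)` (`exists_exact_penalty`).

This is expanded to first order along `z + h / (k + 1)` with smooth `h`. The distance from a convex
set has at its points the directional derivative `w ↦ dist(w; C)`, where `C` is the cone of directions
into the set (`tendsto_mul_infDist`), and limits pass under the integrals by dominated convergence.
For `g` the domination needs a bound of `∇ₓg` on a tube around `z`, whereas the hypothesis bounds it
along each curve separately; a measurable selection gives the uniform bound
(`exists_fderiv_bound`). The result is `0 ≤ ℓ(h) + N(L h)`, with `ℓ(h)` the derivative of the cost,
`L h = (ḣ + ∇ₓg h, (h(0), h(T)))` and `N` a sublinear functional made of distances from cones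
(`exists_variational_inequality`).

As `∇ₓg` is bounded along `z`, the operator `L` maps smooth curves into `L² × (ℝⁿ × ℝⁿ)`, a product
of Hilbert spaces on which `N` is bounded. So the Hahn–Banach theorem and the Riesz representation
yield `q ∈ L²` and a vector `e` with `ℓ(h) + ⟨(q, e), L h⟩ = 0` for all smooth `h` and
`⟨(q, e), ·⟩ ≤ N` on the whole space.
The domination localizes to `q(t) ∈ N_{Ω₁}` almost everywhere and `e ∈ N_{Ω₂}`
(`exists_multipliers`). The lemma of du Bois-Reymond turns the identity into the existence of an
absolutely continuous `p` equal to `q + ∇ᵥϑ` almost everywhere, with derivative `∇ₓϑ + ∇ₓg* q` and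
with boundary values read off from `∇φ + e`; these are the three assertions.
-/

open Filter Topology

namespace ExtBolza

/-! ### Absolutely continuous curves in Euclidean space -/

section AbsolutelyContinuous

variable {n : ℕ} {a b : ℝ}

theorem ac_of_dist_le {X Y : Type*} [PseudoMetricSpace X] [PseudoMetricSpace Y] {f : ℝ → X}
    {g : ℝ → Y} (hg : AbsolutelyContinuousOnInterval g a b)
    (h : ∀ s ∈ uIcc a b, ∀ t ∈ uIcc a b, dist (f s) (f t) ≤ dist (g s) (g t)) :
    AbsolutelyContinuousOnInterval f a b := by
  rw [absolutelyContinuousOnInterval_iff] at hg ⊢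
  intro ε hε
  obtain ⟨δ, hδ, H⟩ := hg ε hε
  refine ⟨δ, hδ, fun E hE hlt => lt_of_le_of_lt (Finset.sum_le_sum fun i hi => ?_) (H E hE hlt)⟩
  exact h _ (hE.1 i hi).1 _ (hE.1 i hi).2

theorem ac_apply {x : ℝ → E n} (hx : AbsolutelyContinuousOnInterval x a b) (i : Fin n) :
    AbsolutelyContinuousOnInterval (fun t => x t i) a b := by
  refine ac_of_dist_le hx fun s _ t _ => ?_
  rw [dist_eq_norm, dist_eq_norm]
  exact PiLp.norm_apply_le (x s - x t) i

theorem ac_sum {F ι : Type*} [SeminormedAddCommGroup F] (s : Finset ι) {f : ι → ℝ → F}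
    (hf : ∀ i ∈ s, AbsolutelyContinuousOnInterval (f i) a b) :
    AbsolutelyContinuousOnInterval (fun t => ∑ i ∈ s, f i t) a b := by
  classical
  induction s using Finset.induction_on with
  | empty =>
    simp only [Finset.sum_empty]
    exact (LipschitzWith.const (0 : F)).lipschitzOnWith.absolutelyContinuousOnInterval
  | insert i s hi ih =>
    simp only [Finset.sum_insert hi]
    exact (hf i (by simp)).add (ih fun j hj => hf j (by simp [hj]))

theorem ac_inner {x y : ℝ → E n} (hx : AbsolutelyContinuousOnInterval x a b)
    (hy : AbsolutelyContinuousOnInterval y a b) :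
    AbsolutelyContinuousOnInterval (fun t => inner ℝ (x t) (y t)) a b := by
  simp only [PiLp.inner_apply, RCLike.inner_apply, conj_trivial]
  exact ac_sum _ fun i _ => (ac_apply hy i).fun_mul (ac_apply hx i)

theorem ac_ae_differentiableAt {x : ℝ → E n} (hx : AbsolutelyContinuousOnInterval x a b) :
    ∀ᵐ t, t ∈ uIcc a b → DifferentiableAt ℝ x t := by
  have : ∀ᵐ t, ∀ i, t ∈ uIcc a b → DifferentiableAt ℝ (fun s => x s i) t :=
    ae_all_iff.2 fun i => (ac_apply hx i).ae_differentiableAt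
  filter_upwards [this] with t ht hmem
  exact differentiableAt_euclidean.2 fun i => ht i hmem

theorem deriv_coord {x : ℝ → E n} {t : ℝ} (hx : DifferentiableAt ℝ x t) (i : Fin n) :
    deriv x t i = deriv (fun s => x s i) t := by
  have := ((EuclideanSpace.proj (𝕜 := ℝ) i).hasFDerivAt.comp_hasDerivAt t hx.hasDerivAt)
  exact this.deriv.symm

/-- Mathlib treats the derivatives of absolutely continuous functions with real values; curves in
Euclidean space are handled coordinate by coordinate. -/
theorem ac_intervalIntegrable_deriv {x : ℝ → E n} (hx : AbsolutelyContinuousOnInterval x a b) :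
    IntervalIntegrable (deriv x) volume a b := by
  rw [intervalIntegrable_iff]
  apply Integrable.of_eval_piLp
  intro i
  have h := (ac_apply hx i).intervalIntegrable_deriv
  rw [intervalIntegrable_iff] at h
  refine h.congr ?_
  filter_upwards [ae_restrict_of_ae (ac_ae_differentiableAt hx), ae_restrict_mem measurableSet_uIoc]
    with t ht hmem
  exact (deriv_coord (ht (uIoc_subset_uIcc hmem)) i).symm

theorem ac_integral_deriv {x : ℝ → E n} (hx : AbsolutelyContinuousOnInterval x a b) :
    ∫ t in a..b, deriv x t = x b - x a := by
  ext i
  have h1 := (EuclideanSpace.proj (𝕜 := ℝ) i).intervalIntegral_comp_comm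
    (ac_intervalIntegrable_deriv hx)
  have h2 := (ac_apply hx i).integral_deriv_eq_sub
  refine h1.symm.trans ?_
  rw [PiLp.sub_apply, ← h2]
  refine intervalIntegral.integral_congr_ae ?_
  filter_upwards [ac_ae_differentiableAt hx] with t ht hmem
  exact deriv_coord (ht (uIoc_subset_uIcc hmem)) i

theorem ac_integral {F : Type*} [NormedAddCommGroup F] [NormedSpace ℝ F] {f : ℝ → F}
    (hf : IntervalIntegrable f volume a b) :
    AbsolutelyContinuousOnInterval (fun t => ∫ s in a..t, f s) a b := by
  have key : ∀ t ∈ uIcc a b, IntervalIntegrable f volume a t := fun t ht =>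
    hf.mono_set (uIcc_subset_uIcc left_mem_uIcc ht)
  refine ac_of_dist_le (hf.norm.absolutelyContinuousOnInterval_intervalIntegral
    (c := a) left_mem_uIcc) fun s hs t ht => ?_
  rw [dist_eq_norm, dist_eq_norm, intervalIntegral.integral_interval_sub_left (key s hs) (key t ht),
    intervalIntegral.integral_interval_sub_left (key s hs).norm (key t ht).norm]
  simpa using! intervalIntegral.norm_integral_le_abs_integral_norm

/-- Integration by parts. -/
theorem ac_integral_inner_deriv {x y : ℝ → E n} (hx : AbsolutelyContinuousOnInterval x a b)
    (hy : AbsolutelyContinuousOnInterval y a b) :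
    ∫ t in a..b, (inner ℝ (x t) (deriv y t) + inner ℝ (deriv x t) (y t)) =
      inner ℝ (x b) (y b) - inner ℝ (x a) (y a) := by
  rw [← (ac_inner hx hy).integral_deriv_eq_sub]
  refine intervalIntegral.integral_congr_ae ?_
  filter_upwards [ac_ae_differentiableAt hx, ac_ae_differentiableAt hy] with t h1 h2 hmem
  have hm := uIoc_subset_uIcc hmem
  exact ((h1 hm).hasDerivAt.inner ℝ (h2 hm).hasDerivAt).deriv.symm

end AbsolutelyContinuous

/-! ### The norm of absolutely continuous curves -/

section AcNorm

variable {n : ℕ} {T : ℝ}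

theorem integral_leb {F : Type*} [NormedAddCommGroup F] [NormedSpace ℝ F] (hT : 0 ≤ T)
    (f : ℝ → F) : ∫ t in (0 : ℝ)..T, f t = ∫ t, f t ∂leb T := by
  rw [intervalIntegral.integral_of_le hT, integral_Icc_eq_integral_Ioc]

theorem intervalIntegrable_leb {F : Type*} [NormedAddCommGroup F] (hT : 0 ≤ T)
    {f : ℝ → F} : IntervalIntegrable f volume 0 T ↔ Integrable f (leb T) := by
  rw [intervalIntegrable_iff_integrableOn_Icc_of_le hT]
  rfl

theorem ac_ae_differentiableAt_leb (hT : 0 ≤ T) {x : ℝ → E n}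
    (hx : AbsolutelyContinuousOnInterval x 0 T) : ∀ᵐ t ∂leb T, DifferentiableAt ℝ x t := by
  filter_upwards [ae_restrict_of_ae (ac_ae_differentiableAt hx), ae_restrict_mem measurableSet_Icc]
    with t ht hmem
  exact ht (by rwa [uIcc_of_le hT])

theorem ac_integrable_deriv_leb (hT : 0 ≤ T) {x : ℝ → E n}
    (hx : AbsolutelyContinuousOnInterval x 0 T) : Integrable (deriv x) (leb T) :=
  (intervalIntegrable_leb hT).1 (ac_intervalIntegrable_deriv hx)

theorem ac_aestronglyMeasurable (hT : 0 ≤ T) {x : ℝ → E n}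
    (hx : AbsolutelyContinuousOnInterval x 0 T) : AEStronglyMeasurable x (leb T) := by
  have := hx.continuousOn
  rw [uIcc_of_le hT] at this
  exact this.aestronglyMeasurable measurableSet_Icc

theorem acNorm_eq (hT : 0 ≤ T) (x : ℝ → E n) : acNorm T x = ‖x 0‖ + ∫ t, ‖deriv x t‖ ∂leb T := by
  rw [acNorm, integral_leb hT]

theorem acNorm_nonneg (hT : 0 ≤ T) (x : ℝ → E n) : 0 ≤ acNorm T x := by
  rw [acNorm_eq hT]
  positivity

/-- `deriv` is additive only where both curves are differentiable, hence only almost everywhere. -/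
theorem ae_deriv_sub (hT : 0 ≤ T) {x y : ℝ → E n} (hx : AbsolutelyContinuousOnInterval x 0 T)
    (hy : AbsolutelyContinuousOnInterval y 0 T) :
    ∀ᵐ t ∂leb T, deriv (x - y) t = deriv x t - deriv y t := by
  filter_upwards [ac_ae_differentiableAt_leb hT hx, ac_ae_differentiableAt_leb hT hy] with t h1 h2
  exact deriv_sub h1 h2

theorem acNorm_sub_le (hT : 0 ≤ T) {x y w : ℝ → E n} (hx : AbsolutelyContinuousOnInterval x 0 T)
    (hy : AbsolutelyContinuousOnInterval y 0 T) (hw : AbsolutelyContinuousOnInterval w 0 T) :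
    acNorm T (x - y) ≤ acNorm T (x - w) + acNorm T (w - y) := by
  rw [acNorm_eq hT, acNorm_eq hT, acNorm_eq hT]
  have h1 : ‖(x - y) 0‖ ≤ ‖(x - w) 0‖ + ‖(w - y) 0‖ := by
    simpa using! norm_sub_le_norm_sub_add_norm_sub (x 0) (w 0) (y 0)
  have h2 : ∫ t, ‖deriv (x - y) t‖ ∂leb T ≤
      ∫ t, (‖deriv (x - w) t‖ + ‖deriv (w - y) t‖) ∂leb T := by
    refine integral_mono_ae (ac_integrable_deriv_leb hT (hx.sub hy)).norm
      ((ac_integrable_deriv_leb hT (hx.sub hw)).norm.add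
        (ac_integrable_deriv_leb hT (hw.sub hy)).norm) ?_
    filter_upwards [ae_deriv_sub hT hx hy, ae_deriv_sub hT hx hw, ae_deriv_sub hT hw hy]
      with t a b c
    simp only [a, b, c]
    exact norm_sub_le_norm_sub_add_norm_sub _ _ _
  rw [integral_add (ac_integrable_deriv_leb hT (hx.sub hw)).norm
        (ac_integrable_deriv_leb hT (hw.sub hy)).norm] at h2
  linarith

theorem acNorm_sub_comm (x y : ℝ → E n) : acNorm T (x - y) = acNorm T (y - x) := by
  rw [← neg_sub x y, acNorm, acNorm, deriv.neg']
  simp [norm_sub_rev]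

theorem acNorm_smul (c : ℝ) (x : ℝ → E n) : acNorm T (c • x) = |c| * acNorm T x := by
  have : ∀ t, deriv (c • x) t = c • deriv x t := fun t => deriv_const_smul_field c x
  simp only [acNorm, Pi.smul_apply, this, norm_smul, Real.norm_eq_abs,
    intervalIntegral.integral_const_mul]
  ring

/-- The norm `acNorm` dominates the uniform norm on `[0, T]`. -/
theorem norm_le_acNorm {x : ℝ → E n} (hx : AbsolutelyContinuousOnInterval x 0 T)
    {t : ℝ} (ht : t ∈ Icc 0 T) : ‖x t‖ ≤ acNorm T x := by
  have hT : 0 ≤ T := ht.1.trans ht.2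
  have hsub : uIcc 0 t ⊆ uIcc 0 T := uIcc_subset_uIcc left_mem_uIcc (by rwa [uIcc_of_le hT])
  have h := ac_integral_deriv (hx.mono hsub)
  have h1 : ‖x t - x 0‖ ≤ ∫ s in (0 : ℝ)..t, ‖deriv x s‖ :=
    h ▸ intervalIntegral.norm_integral_le_integral_norm ht.1
  have h2 : ∫ s in (0 : ℝ)..t, ‖deriv x s‖ ≤ ∫ s in (0 : ℝ)..T, ‖deriv x s‖ :=
    intervalIntegral.integral_mono_interval le_rfl ht.1 ht.2
      (ae_of_all _ fun _ => norm_nonneg _) (ac_intervalIntegrable_deriv hx).norm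
  have h3 : ‖x t‖ ≤ ‖x 0‖ + ‖x t - x 0‖ := norm_le_insert' _ _
  rw [acNorm]
  linarith

end AcNorm

/-! ### Tangent directions of convex sets -/

section FeasibleCone

variable {H : Type*} [NormedAddCommGroup H] [InnerProductSpace ℝ H] {Ω : Set H} {a : H}

/-- The cone of directions that lead from `a` into `Ω`. For convex `Ω` its closure is the tangent
cone; only distances to it are used, so that the closure need not be taken. -/
def feasibleCone (Ω : Set H) (a : H) : Set H := {w | ∃ s > (0 : ℝ), a + s • w ∈ Ω}

theorem zero_mem_feasibleCone (ha : a ∈ Ω) : (0 : H) ∈ feasibleCone Ω a :=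
  ⟨1, one_pos, by simpa⟩

theorem sub_mem_feasibleCone {w : H} (hw : w ∈ Ω) : w - a ∈ feasibleCone Ω a :=
  ⟨1, one_pos, by simpa⟩

theorem smul_mem_feasibleCone {c : ℝ} (hc : 0 < c) {w : H} (hw : w ∈ feasibleCone Ω a) :
    c • w ∈ feasibleCone Ω a := by
  obtain ⟨s, hs, h⟩ := hw
  refine ⟨s / c, by positivity, ?_⟩
  rwa [smul_smul, div_mul_cancel₀ _ hc.ne']

theorem add_smul_mem_of_le (hΩ : Convex ℝ Ω) (ha : a ∈ Ω) {w : H} {s r : ℝ} (hr : 0 ≤ r)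
    (hrs : r ≤ s) (hs : 0 < s) (h : a + s • w ∈ Ω) : a + r • w ∈ Ω := by
  have := hΩ.add_smul_mem ha h (t := r / s) ⟨by positivity, (div_le_one hs).2 hrs⟩
  rwa [smul_smul, div_mul_cancel₀ _ hs.ne'] at this

theorem add_mem_feasibleCone (hΩ : Convex ℝ Ω) (ha : a ∈ Ω) {v w : H}
    (hv : v ∈ feasibleCone Ω a) (hw : w ∈ feasibleCone Ω a) : v + w ∈ feasibleCone Ω a := by
  obtain ⟨s, hs, h⟩ := hv
  obtain ⟨r, hr, h'⟩ := hw
  have hm : 0 < min s r := lt_min hs hr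
  refine ⟨min s r / 2, by positivity, ?_⟩
  have h1 := add_smul_mem_of_le hΩ ha hm.le (min_le_left s r) hs h
  have h2 := add_smul_mem_of_le hΩ ha hm.le (min_le_right s r) hr h'
  have := hΩ h1 h2 (a := 1 / 2) (b := 1 / 2) (by norm_num) (by norm_num) (by norm_num)
  convert this using 1
  module

theorem infDist_feasibleCone_smul (ha : a ∈ Ω) {c : ℝ} (hc : 0 < c) (w : H) :
    Metric.infDist (c • w) (feasibleCone Ω a) = c * Metric.infDist w (feasibleCone Ω a) := by
  have hle : ∀ {c : ℝ}, 0 < c → ∀ w : H,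
      Metric.infDist (c • w) (feasibleCone Ω a) ≤ c * Metric.infDist w (feasibleCone Ω a) := by
    intro c hc w
    rw [← div_le_iff₀' hc]
    refine (Metric.le_infDist ⟨0, zero_mem_feasibleCone ha⟩).2 fun y hy => ?_
    rw [div_le_iff₀' hc]
    refine (Metric.infDist_le_dist_of_mem (smul_mem_feasibleCone hc hy)).trans ?_
    rw [dist_smul₀, Real.norm_eq_abs, abs_of_pos hc]
  refine le_antisymm (hle hc w) ?_
  have := hle (inv_pos.2 hc) (c • w)
  rwa [inv_smul_smul₀ hc.ne', le_inv_mul_iff₀ hc] at this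

theorem infDist_feasibleCone_add_le (hΩ : Convex ℝ Ω) (ha : a ∈ Ω) (v w : H) :
    Metric.infDist (v + w) (feasibleCone Ω a) ≤
      Metric.infDist v (feasibleCone Ω a) + Metric.infDist w (feasibleCone Ω a) := by
  have hne : (feasibleCone Ω a).Nonempty := ⟨0, zero_mem_feasibleCone ha⟩
  rw [← sub_le_iff_le_add]
  refine (Metric.le_infDist hne).2 fun y hy => ?_
  rw [sub_le_iff_le_add, ← sub_le_iff_le_add']
  refine (Metric.le_infDist hne).2 fun x hx => ?_
  rw [sub_le_iff_le_add]
  refine (Metric.infDist_le_dist_of_mem (add_mem_feasibleCone hΩ ha hy hx)).trans ?_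
  rw [add_comm (dist w x)]
  exact dist_add_add_le v w y x

theorem infDist_feasibleCone_le_norm (ha : a ∈ Ω) (w : H) :
    Metric.infDist w (feasibleCone Ω a) ≤ ‖w‖ := by
  simpa using Metric.infDist_le_dist_of_mem (x := w) (zero_mem_feasibleCone ha)

/-- The distance from a convex set has, at a point of the set, a directional derivative: the
distance from the feasible cone. The difference quotients may be taken along any sequence of
points that is tangent to the direction. -/
theorem tendsto_mul_infDist (hΩ : Convex ℝ Ω) (ha : a ∈ Ω) {u : ℕ → H} {w : H}
    (hu : Tendsto (fun k : ℕ => ((k : ℝ) + 1) • (u k - a)) atTop (𝓝 w)) :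
    Tendsto (fun k : ℕ => ((k : ℝ) + 1) * Metric.infDist (u k) Ω) atTop
      (𝓝 (Metric.infDist w (feasibleCone Ω a))) := by
  have hpos : ∀ k : ℕ, (0 : ℝ) < (k : ℝ) + 1 := fun k => by positivity
  have hne : (feasibleCone Ω a).Nonempty := ⟨0, zero_mem_feasibleCone ha⟩
  have hcont : Tendsto (fun k : ℕ => Metric.infDist (((k : ℝ) + 1) • (u k - a)) (feasibleCone Ω a))
      atTop (𝓝 (Metric.infDist w (feasibleCone Ω a))) :=
    ((Metric.continuous_infDist_pt _).tendsto w).comp hu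
  -- the quotients dominate the distance from the cone, as the cone contains `(k + 1) • (Ω - a)`
  have hlow : ∀ k : ℕ, Metric.infDist (((k : ℝ) + 1) • (u k - a)) (feasibleCone Ω a) ≤
      ((k : ℝ) + 1) * Metric.infDist (u k) Ω := by
    intro k
    rw [← div_le_iff₀' (hpos k)]
    refine (Metric.le_infDist ⟨a, ha⟩).2 fun y hy => ?_
    rw [div_le_iff₀' (hpos k)]
    refine (Metric.infDist_le_dist_of_mem
      (smul_mem_feasibleCone (hpos k) (sub_mem_feasibleCone hy))).trans ?_
    rw [dist_smul₀, Real.norm_eq_abs, abs_of_pos (hpos k), dist_sub_right]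
  refine tendsto_order.2 ⟨fun c hc => ?_, fun c hc => ?_⟩
  · filter_upwards [(tendsto_order.1 hcont).1 c hc] with k hk using hk.trans_le (hlow k)
  · obtain ⟨y, hy, hyc⟩ := (Metric.infDist_lt_iff hne).1 hc
    obtain ⟨s, hs, hsy⟩ := hy
    have h1 : ∀ᶠ k : ℕ in atTop, dist (((k : ℝ) + 1) • (u k - a)) y < c :=
      (tendsto_order.1 (hu.dist (tendsto_const_nhds (x := y)))).2 c hyc
    have h2 : ∀ᶠ k : ℕ in atTop, 1 / ((k : ℝ) + 1) < s :=
      (tendsto_order.1 tendsto_one_div_add_atTop_nhds_zero_nat).2 s hs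
    filter_upwards [h1, h2] with k hk1 hk2
    have hmem := add_smul_mem_of_le hΩ ha (one_div_pos.2 (hpos k)).le hk2.le hs hsy
    refine lt_of_le_of_lt ?_ hk1
    calc ((k : ℝ) + 1) * Metric.infDist (u k) Ω
        ≤ ((k : ℝ) + 1) * dist (u k) (a + (1 / ((k : ℝ) + 1)) • y) := by
          gcongr; exact Metric.infDist_le_dist_of_mem hmem
      _ = dist (((k : ℝ) + 1) • (u k - a)) y := by
          rw [dist_eq_norm, dist_eq_norm, ← abs_of_pos (hpos k), ← Real.norm_eq_abs, ← norm_smul,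
            Real.norm_eq_abs, abs_of_pos (hpos k)]
          congr 1
          rw [smul_sub, smul_sub, smul_add, smul_smul, mul_one_div_cancel (hpos k).ne', one_smul]
          abel

end FeasibleCone

/-! ### Measurable selections -/

/-- A countable family of measurable functions, pointwise bounded above, is essentially bounded
uniformly as soon as every measurable selection from it is. -/
theorem exists_ae_forall_le_of_selections {α : Type*} [MeasurableSpace α] {μ : Measure α}
    {f : ℕ → α → ℝ} (hf : ∀ j, AEMeasurable (f j) μ)
    (hbdd : ∀ᵐ t ∂μ, BddAbove (range fun j => f j t))
    (hsel : ∀ σ : α → ℕ, Measurable σ → ∃ C, ∀ᵐ t ∂μ, f (σ t) t ≤ C) :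
    ∃ C, ∀ᵐ t ∂μ, ∀ j, f j t ≤ C := by
  classical
  set g : ℕ → α → ℝ := fun j => (hf j).mk (f j)
  have hg : ∀ j, Measurable (g j) := fun j => (hf j).measurable_mk
  have hfg : ∀ᵐ t ∂μ, ∀ j, f j t = g j t := ae_all_iff.2 fun j => (hf j).ae_eq_mk
  -- an almost maximal index, or zero where there is none
  let p : α → ℕ → Prop := fun t j => (∀ i, g i t ≤ g j t + 1) ∨ ∀ k, ∃ i, g k t + 1 < g i t
  have hp : ∀ t, ∃ j, p t j := by
    intro t
    by_cases h : ∃ j, ∀ i, g i t ≤ g j t + 1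
    · exact ⟨h.choose, Or.inl h.choose_spec⟩
    · push Not at h
      exact ⟨0, Or.inr h⟩
  have hm : ∀ j, MeasurableSet {t | p t j} := by
    intro j
    have : {t | p t j} = (⋂ i, {t | g i t ≤ g j t + 1}) ∪ ⋂ k, ⋃ i, {t | g k t + 1 < g i t} := by
      ext; simp [p]
    rw [this]
    exact (MeasurableSet.iInter fun i => measurableSet_le (hg i) ((hg j).add_const 1)).union
      (MeasurableSet.iInter fun k => MeasurableSet.iUnion fun i =>
        measurableSet_lt ((hg k).add_const 1) (hg i))
  obtain ⟨C, hC⟩ := hsel (fun t => Nat.find (hp t)) (measurable_find hp hm)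
  refine ⟨C + 1, ?_⟩
  filter_upwards [hC, hfg, hbdd] with t h1 h2 h3 j
  have h4 : ∀ i, g i t ≤ g (Nat.find (hp t)) t + 1 := by
    rcases Nat.find_spec (hp t) with h | h
    · exact h
    · exfalso
      simp only [h2] at h3
      obtain ⟨_, ⟨k, rfl⟩, hk⟩ := exists_lt_of_lt_csSup (range_nonempty fun j => g j t)
        (sub_one_lt (sSup (range fun j => g j t)))
      obtain ⟨i, hi⟩ := h k
      have := le_csSup h3 ⟨i, rfl⟩
      simp only at hk this
      linarith
  rw [h2] at h1 ⊢
  linarith [h4 j]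

/-! ### The dynamics along curves near the minimizer -/

theorem MemLp_top_exists_bound {α F : Type*} [MeasurableSpace α] {μ : Measure α}
    [NormedAddCommGroup F] {f : α → F} (hf : MemLp f ⊤ μ) : ∃ C, ∀ᵐ t ∂μ, ‖f t‖ ≤ C := by
  have hlt := hf.eLpNorm_lt_top
  rw [eLpNorm_exponent_top] at hlt
  refine ⟨(eLpNormEssSup f μ).toReal, ?_⟩
  filter_upwards [ae_le_eLpNormEssSup (f := f) (μ := μ)] with t ht
  have := ENNReal.toReal_mono hlt.ne ht
  simpa using this

namespace Problem

variable {n : ℕ} {P : Problem n} {z : ℝ → E n}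

/-- Boundedness of `∇ₓg` along each measurable curve near `z` is uniform: a bound valid on a whole
tube around `z` comes from a measurable almost maximal selection among countably many
translates of `z`. -/
theorem exists_fderiv_bound (h4 : P.H4 z) (hz : AEStronglyMeasurable z (leb P.T)) :
    ∃ ε > 0, ∃ M ≥ 0,
      (∀ x : ℝ → E n, AEStronglyMeasurable x (leb P.T) → (∀ᵐ t ∂leb P.T, ‖x t - z t‖ ≤ ε) →
        AEStronglyMeasurable (fun t => P.g t (x t)) (leb P.T)) ∧
      AEStronglyMeasurable (fun t => fderiv ℝ (P.g t) (z t)) (leb P.T) ∧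
      (∀ᵐ t ∂leb P.T, ContDiff ℝ 1 (P.g t)) ∧
      ∀ᵐ t ∂leb P.T, ∀ y ∈ Metric.closedBall (z t) ε, ‖fderiv ℝ (P.g t) y‖ ≤ M := by
  obtain ⟨hC1, -, -, ε, hε, H⟩ := h4
  have hne : Nonempty (Metric.closedBall (0 : E n) ε) := ⟨⟨0, by simp [hε.le]⟩⟩
  set y : ℕ → E n := fun j => TopologicalSpace.denseSeq (Metric.closedBall (0 : E n) ε) j
  have hy : ∀ j, ‖y j‖ ≤ ε := fun j =>
    mem_closedBall_zero_iff.1 (TopologicalSpace.denseSeq (Metric.closedBall (0 : E n) ε) j).2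
  have hsel : ∀ σ : ℝ → ℕ, Measurable σ →
      MemLp (fun t => fderiv ℝ (P.g t) (z t + y (σ t))) ⊤ (leb P.T) := by
    intro σ hσ
    refine (H (fun t => z t + y (σ t)) (hz.add ?_) (ae_of_all _ fun t => ?_)).2
    · exact ((measurable_from_nat (f := y)).comp hσ).aestronglyMeasurable
    · simpa using hy _
  obtain ⟨C, hC⟩ := exists_ae_forall_le_of_selections (μ := leb P.T)
    (f := fun j t => ‖fderiv ℝ (P.g t) (z t + y j)‖)
    (fun j => (hsel (fun _ => j) measurable_const).1.norm.aemeasurable)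
    (by
      filter_upwards [hC1] with t ht
      have hcont : Continuous fun w : Metric.closedBall (0 : E n) ε =>
          ‖fderiv ℝ (P.g t) (z t + w)‖ :=
        ((ht.continuous_fderiv one_ne_zero).comp (by fun_prop)).norm
      refine (isCompact_range hcont).bddAbove.mono ?_
      rintro _ ⟨j, rfl⟩
      exact ⟨_, rfl⟩)
    (fun σ hσ => MemLp_top_exists_bound (hsel σ hσ))
  refine ⟨ε, hε, max C 0, le_max_right _ _, fun x hx hxz => (H x hx hxz).1.1, ?_, hC1, ?_⟩
  · exact (H z hz (ae_of_all _ fun t => by simpa using hε.le)).2.1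
  · filter_upwards [hC1, hC] with t ht hCt w hw
    refine le_max_of_le_left ?_
    have hcont : Continuous fun w : Metric.closedBall (0 : E n) ε =>
        ‖fderiv ℝ (P.g t) (z t + w)‖ :=
      ((ht.continuous_fderiv one_ne_zero).comp (by fun_prop)).norm
    have := (TopologicalSpace.denseRange_denseSeq (Metric.closedBall (0 : E n) ε)).induction_on
      (p := fun w => ‖fderiv ℝ (P.g t) (z t + w)‖ ≤ C) (⟨w - z t, by
        simpa [dist_eq_norm] using hw⟩)
      (isClosed_le hcont continuous_const) hCt
    simpa using this

/-- On a tube around `z` the dynamics `g(t, ·)` is Lipschitz at `z(t)`, uniformly in `t`. -/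
theorem exists_tube (h4 : P.H4 z) (hz : AEStronglyMeasurable z (leb P.T)) :
    ∃ ε > 0, ∃ M ≥ 0,
      (∀ x : ℝ → E n, AEStronglyMeasurable x (leb P.T) → (∀ᵐ t ∂leb P.T, ‖x t - z t‖ ≤ ε) →
        AEStronglyMeasurable (fun t => P.g t (x t)) (leb P.T)) ∧
      AEStronglyMeasurable (fun t => fderiv ℝ (P.g t) (z t)) (leb P.T) ∧
      (∀ᵐ t ∂leb P.T, DifferentiableAt ℝ (P.g t) (z t)) ∧
      (∀ᵐ t ∂leb P.T, ‖fderiv ℝ (P.g t) (z t)‖ ≤ M) ∧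
      ∀ᵐ t ∂leb P.T, ∀ y, ‖y - z t‖ ≤ ε → ‖P.g t y - P.g t (z t)‖ ≤ M * ‖y - z t‖ := by
  obtain ⟨ε, hε, M, hM, hmeas, hmeas', hC1, hb⟩ := exists_fderiv_bound h4 hz
  refine ⟨ε, hε, M, hM, hmeas, hmeas', ?_, ?_, ?_⟩
  · filter_upwards [hC1] with t ht using ht.differentiable one_ne_zero _
  · filter_upwards [hb] with t ht using ht _ (Metric.mem_closedBall_self hε.le)
  · filter_upwards [hC1, hb] with t ht hbt y hy
    exact (convex_closedBall (z t) ε).norm_image_sub_le_of_norm_fderiv_le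
      (fun w _ => ht.differentiable one_ne_zero w) hbt (Metric.mem_closedBall_self hε.le)
      (by simpa [dist_eq_norm] using hy)

/-! ### Exact penalization -/

theorem ac (P : Problem n) {x : ℝ → E n} (hx : x ∈ P.X) : AbsolutelyContinuousOnInterval x 0 P.T :=
  P.ac_of_mem x hx

theorem norm_endpoints_sub_le {x y : ℝ → E n} (hx : x ∈ P.X) (hy : y ∈ P.X) :
    ‖endpoints P.T x - endpoints P.T y‖ ≤ 2 * acNorm P.T (x - y) := by
  have hxy := (P.ac hx).sub (P.ac hy)
  have h0 : ‖x 0 - y 0‖ ≤ acNorm P.T (x - y) :=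
    norm_le_acNorm hxy (t := 0) ⟨le_rfl, P.T_pos.le⟩
  have hT : ‖x P.T - y P.T‖ ≤ acNorm P.T (x - y) :=
    norm_le_acNorm hxy (t := P.T) ⟨P.T_pos.le, le_rfl⟩
  have : endpoints P.T x - endpoints P.T y = WithLp.toLp 2 (x 0 - y 0, x P.T - y P.T) := rfl
  rw [this, WithLp.prod_norm_eq_of_L2]
  refine Real.sqrt_le_iff.2 ⟨by positivity [acNorm_nonneg P.T_pos.le (x - y)], ?_⟩
  change ‖x 0 - y 0‖ ^ 2 + ‖x P.T - y P.T‖ ^ 2 ≤ _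
  nlinarith [norm_nonneg (x 0 - y 0), norm_nonneg (x P.T - y P.T)]

/-- Near `z` the cost is finite and Lipschitz in `acNorm` on all of `X`. -/
theorem exists_J_lipschitz (hz : z ∈ P.feasible) (h1 : P.H1 z) (h2 : P.H2 z) :
    ∃ δ > 0, ∃ K ≥ 0, ∀ x ∈ P.X, ∀ y ∈ P.X, acNorm P.T (x - z) < δ → acNorm P.T (y - z) < δ →
      Integrable (fun t => P.ϑ t (x t) (deriv x t)) (leb P.T) ∧
      |P.J x - P.J y| ≤ K * acNorm P.T (x - y) := by
  have hT := P.T_pos.le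
  obtain ⟨C, s, hs, hφ⟩ := h1.exists_lipschitzOnWith
  obtain ⟨r, hr, hrs⟩ := Metric.mem_nhds_iff.1 hs
  obtain ⟨-, -, ε, hε, hmeas, L, hL⟩ := h2
  have hint : ∀ x ∈ P.X, acNorm P.T (x - z) ≤ ε →
      Integrable (fun t => P.ϑ t (x t) (deriv x t)) (leb P.T) := by
    intro x hx hxz
    have hzint := (intervalIntegrable_leb hT).1 hz.2.2.2
    have hxz' := (P.ac hx).sub (P.ac hz.1)
    have hd : Integrable
        (fun t => P.ϑ t (x t) (deriv x t) - P.ϑ t (z t) (deriv z t)) (leb P.T) := by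
      refine Integrable.mono' (g := fun t => |L| * (acNorm P.T (x - z) + ‖deriv (x - z) t‖)) ?_
        ((hmeas x hx hxz).aestronglyMeasurable.sub hzint.1) ?_
      · exact ((integrable_const _).add (ac_integrable_deriv_leb hT hxz').norm).const_mul _
      · filter_upwards [hL x hx z hz.1 hxz (by simpa [acNorm] using hε.le),
          ae_deriv_sub hT (P.ac hx) (P.ac hz.1), ae_restrict_mem measurableSet_Icc] with t ht hd hm
        have := norm_le_acNorm hxz' hm
        rw [hd]
        refine ht.trans ((mul_le_mul_of_nonneg_right (le_abs_self L) (by positivity)).trans ?_)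
        gcongr
        exact this
    exact (hd.add hzint).congr (ae_of_all _ fun t => by simp)
  refine ⟨min (r / 2) ε, by positivity, C * 2 + |L| * (P.T + 1), by positivity,
    fun x hx y hy hxz hyz => ⟨hint x hx (hxz.le.trans (min_le_right _ _)), ?_⟩⟩
  have hxr : endpoints P.T x ∈ s := hrs (by
    rw [mem_ball_iff_norm]
    linarith [norm_endpoints_sub_le hx hz.1, hxz.trans_le (min_le_left _ _)])
  have hyr : endpoints P.T y ∈ s := hrs (by
    rw [mem_ball_iff_norm]
    linarith [norm_endpoints_sub_le hy hz.1, hyz.trans_le (min_le_left _ _)])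
  have hφxy : |P.φ (endpoints P.T x) - P.φ (endpoints P.T y)| ≤ C * 2 * acNorm P.T (x - y) := by
    have := hφ.dist_le_mul _ hxr _ hyr
    rw [Real.dist_eq, dist_eq_norm] at this
    refine this.trans ?_
    rw [mul_assoc]
    gcongr
    exact norm_endpoints_sub_le hx hy
  have hx' := hint x hx (hxz.le.trans (min_le_right _ _))
  have hy' := hint y hy (hyz.le.trans (min_le_right _ _))
  have hxy' := (P.ac hx).sub (P.ac hy)
  have hI : |∫ t, (P.ϑ t (x t) (deriv x t) - P.ϑ t (y t) (deriv y t)) ∂leb P.T| ≤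
      |L| * (P.T + 1) * acNorm P.T (x - y) := by
    calc |∫ t, (P.ϑ t (x t) (deriv x t) - P.ϑ t (y t) (deriv y t)) ∂leb P.T|
        ≤ ∫ t, |L| * (acNorm P.T (x - y) + ‖deriv (x - y) t‖) ∂leb P.T := by
          refine norm_integral_le_of_norm_le (f := fun t =>
            P.ϑ t (x t) (deriv x t) - P.ϑ t (y t) (deriv y t))
            (((integrable_const _).add (ac_integrable_deriv_leb hT hxy').norm).const_mul _) ?_
          filter_upwards [hL x hx y hy (hxz.le.trans (min_le_right _ _))
            (hyz.le.trans (min_le_right _ _)), ae_deriv_sub hT (P.ac hx) (P.ac hy),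
            ae_restrict_mem measurableSet_Icc] with t ht hd hm
          have := norm_le_acNorm hxy' hm
          rw [hd]
          refine ht.trans ((mul_le_mul_of_nonneg_right (le_abs_self L) (by positivity)).trans ?_)
          gcongr
          exact this
      _ ≤ |L| * (P.T + 1) * acNorm P.T (x - y) := by
          rw [integral_const_mul, integral_add (integrable_const _)
            (ac_integrable_deriv_leb hT hxy').norm, integral_const, mul_assoc]
          gcongr
          have hd : ∫ t, ‖deriv (x - y) t‖ ∂leb P.T ≤ acNorm P.T (x - y) := by
            rw [acNorm_eq hT]
            linarith [norm_nonneg ((x - y) 0)]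
          have hm : (leb P.T).real univ = P.T := by
            simp [Measure.real, hT]
          rw [hm, smul_eq_mul]
          linarith
  rw [integral_sub hx' hy'] at hI
  have : P.J x - P.J y = (P.φ (endpoints P.T x) - P.φ (endpoints P.T y)) +
      (∫ t, P.ϑ t (x t) (deriv x t) ∂leb P.T - ∫ t, P.ϑ t (y t) (deriv y t) ∂leb P.T) := by
    rw [J, J, integral_leb hT, integral_leb hT]
    ring
  rw [this]
  refine (abs_add_le _ _).trans ?_
  linarith

/-- Under metric subregularity the constraints may be replaced by a penalty: the cost being
Lipschitz, leaving the feasible set gains at most a multiple of the distance from it. -/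
theorem exists_exact_penalty (hmin : P.IsStrongLocalMin z) (h1 : P.H1 z) (h2 : P.H2 z)
    (h5 : P.H5 z) :
    ∃ δ > 0, ∃ K ≥ 0, ∀ x ∈ P.X, acNorm P.T (x - z) < δ →
      Integrable (fun t => P.ϑ t (x t) (deriv x t)) (leb P.T) ∧
      0 ≤ P.J x - P.J z +
        K * (∫ t, Metric.infDist (deriv x t + P.g t (x t)) P.Ω₁ ∂leb P.T) +
        K * Metric.infDist (endpoints P.T x) P.Ω₂ := by
  have hT := P.T_pos.le
  obtain ⟨hz, ε, hε, hle⟩ := hmin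
  obtain ⟨δ, hδ, K, hK, hJ⟩ := exists_J_lipschitz hz h1 h2
  obtain ⟨κ, hκ, δ', hδ', hκd⟩ := h5
  have hzz : acNorm P.T (z - z) = 0 := by simp [acNorm]
  -- a feasible `u` nearly closest to `x` is, up to an error, no farther from `x` than `z`; a third
  -- of the radius then keeps `u` where the cost is Lipschitz and `z` is minimal
  refine ⟨min (min δ ε / 3) δ', by positivity, K * κ, by positivity, fun x hx hxz => ?_⟩
  have hm : 0 < min δ ε := by positivity
  have hxz1 : acNorm P.T (x - z) < min δ ε / 3 := hxz.trans_le (min_le_left _ _)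
  have hxδ : acNorm P.T (x - z) < δ := by
    linarith [min_le_left δ ε]
  refine ⟨(hJ x hx z hz.1 hxδ (by rwa [hzz])).1, ?_⟩
  have hne : ((fun u => acNorm P.T (x - u)) '' P.feasible).Nonempty := ⟨_, z, hz, rfl⟩
  have hbdd : BddBelow ((fun u => acNorm P.T (x - u)) '' P.feasible) :=
    ⟨0, by rintro _ ⟨u, -, rfl⟩; exact acNorm_nonneg hT _⟩
  have hdz : acDist P.T x P.feasible ≤ acNorm P.T (x - z) := csInf_le hbdd ⟨z, hz, rfl⟩
  have key : 0 ≤ P.J x - P.J z + K * acDist P.T x P.feasible := by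
    refine le_of_forall_pos_le_add fun η hη => ?_
    obtain ⟨_, ⟨u, hu, rfl⟩, hux⟩ := exists_lt_of_csInf_lt hne
      (show acDist P.T x P.feasible < acDist P.T x P.feasible + min (η / (K + 1)) (min δ ε / 3) by
        have : 0 < min (η / (K + 1)) (min δ ε / 3) := by positivity
        linarith)
    simp only at hux
    have hux1 := hux.le.trans (add_le_add_right (min_le_left _ _) _)
    have hux2 := hux.le.trans (add_le_add_right (min_le_right _ _) _)
    have huz : acNorm P.T (u - z) < min δ ε := by
      have := acNorm_sub_le hT (P.ac hu.1) (P.ac hz.1) (P.ac hx)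
      rw [acNorm_sub_comm u x] at this
      linarith
    have hJu := hle u hu (huz.trans_le (min_le_right _ _))
    have hJx := (abs_le.1 (hJ x hx u hu.1 hxδ (huz.trans_le (min_le_left _ _))).2).1
    have hKη : K * (η / (K + 1)) ≤ η := by
      rw [mul_div_assoc', div_le_iff₀ (by positivity)]
      nlinarith
    nlinarith
  have h := mul_le_mul_of_nonneg_left (hκd x hx (hxz.trans_le (min_le_right _ _))) hK
  rw [integral_leb hT] at h
  linarith

/-! ### First-order expansion of the penalized cost -/

/-- The velocity of the constraint linearized along `z`: `ḣ + ∇ₓg(t, z) h`. -/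
noncomputable def linVel (P : Problem n) (z h : ℝ → E n) (t : ℝ) : E n :=
  deriv h t + fderiv ℝ (P.g t) (z t) (h t)

/-- The directions into `Ω₁` at `ż(t) + g(t, z(t))`. -/
noncomputable def velCone (P : Problem n) (z : ℝ → E n) (t : ℝ) : Set (E n) :=
  feasibleCone P.Ω₁ (deriv z t + P.g t (z t))

/-- Directional difference quotients along the steps `1 / (k + 1)`, as used for all variations. -/
theorem tendsto_smul_sub {F G : Type*} [NormedAddCommGroup F] [NormedSpace ℝ F]
    [NormedAddCommGroup G] [NormedSpace ℝ G] {f : F → G} {f' : F →L[ℝ] G} {a : F}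
    (hf : HasFDerivAt f f' a) (v : F) :
    Tendsto (fun k : ℕ => ((k : ℝ) + 1) • (f (a + ((k : ℝ) + 1)⁻¹ • v) - f a)) atTop
      (𝓝 (f' v)) :=
  (hf.lim_real v).comp (tendsto_natCast_atTop_atTop.atTop_add tendsto_const_nhds)

theorem mem_X_of_contDiff {h : ℝ → E n} (hh : ContDiff ℝ ∞ h) : h ∈ P.X :=
  P.mem_of_smooth h hh.contDiffOn

theorem add_smul_mem_X (hz : z ∈ P.X) {h : ℝ → E n} (hh : ContDiff ℝ ∞ h) (c : ℝ) :
    z + c • h ∈ P.X :=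
  P.X.add_mem hz (P.X.smul_mem c (mem_X_of_contDiff hh))

theorem acNorm_add_smul_sub (h : ℝ → E n) (c : ℝ) :
    acNorm P.T (z + c • h - z) = |c| * acNorm P.T h := by
  rw [add_sub_cancel_left, acNorm_smul]

theorem eventually_acNorm_lt (h : ℝ → E n) {δ : ℝ} (hδ : 0 < δ) :
    ∀ᶠ k : ℕ in atTop, acNorm P.T (z + ((k : ℝ) + 1)⁻¹ • h - z) < δ := by
  have : Tendsto (fun k : ℕ => |((k : ℝ) + 1)⁻¹| * acNorm P.T h) atTop (𝓝 0) := by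
    simpa [one_div] using
      (tendsto_one_div_add_atTop_nhds_zero_nat (𝕜 := ℝ)).abs.mul_const (acNorm P.T h)
  filter_upwards [(tendsto_order.1 this).2 δ hδ] with k hk
  rwa [acNorm_add_smul_sub]

theorem ae_deriv_add_smul (hz : z ∈ P.X) {h : ℝ → E n} (hh : ContDiff ℝ ∞ h) :
    ∀ᵐ t ∂leb P.T, ∀ c : ℝ, deriv (z + c • h) t = deriv z t + c • deriv h t := by
  filter_upwards [ac_ae_differentiableAt_leb P.T_pos.le (P.ac hz)] with t ht c
  have hd : DifferentiableAt ℝ h t := hh.differentiable (by simp) t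
  rw [deriv_add ht (hd.const_smul c), deriv_const_smul c hd]

theorem fderiv_cost_apply {t : ℝ}
    (ht : ContDiffAt ℝ 1 (fun y : E n × E n => P.ϑ t y.1 y.2) (z t, deriv z t)) (v w : E n) :
    fderiv ℝ (fun y : E n × E n => P.ϑ t y.1 y.2) (z t, deriv z t) (v, w) =
      inner ℝ (P.gradX z t) v + inner ℝ (P.gradV z t) w := by
  have hd := (ht.differentiableAt one_ne_zero).hasFDerivAt
  set D := fderiv ℝ (fun y : E n × E n => P.ϑ t y.1 y.2) (z t, deriv z t)
  have hX : HasFDerivAt (fun a => P.ϑ t a (deriv z t)) (D.comp (.inl ℝ _ _)) (z t) :=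
    hd.comp (f := fun a => (a, deriv z t)) (z t) (hasFDerivAt_prodMk_left _ _)
  have hV : HasFDerivAt (fun v => P.ϑ t (z t) v) (D.comp (.inr ℝ _ _)) (deriv z t) :=
    hd.comp (f := fun v => (z t, v)) (deriv z t) (hasFDerivAt_prodMk_right _ _)
  rw [gradX, gradV, gradient, gradient, InnerProductSpace.toDual_symm_apply,
    InnerProductSpace.toDual_symm_apply, hX.fderiv, hV.fderiv]
  simp [← map_add]

/-- The derivative of the running cost in the direction of `h`. -/
noncomputable def costVar (P : Problem n) (z h : ℝ → E n) (t : ℝ) : ℝ :=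
  inner ℝ (P.gradX z t) (h t) + inner ℝ (P.gradV z t) (deriv h t)

theorem tendsto_cost_quotient (hz : z ∈ P.X) (h2 : P.H2 z) {h : ℝ → E n} (hh : ContDiff ℝ ∞ h) :
    ∀ᵐ t ∂leb P.T, Tendsto (fun k : ℕ => ((k : ℝ) + 1) *
      (P.ϑ t ((z + ((k : ℝ) + 1)⁻¹ • h) t) (deriv (z + ((k : ℝ) + 1)⁻¹ • h) t) -
        P.ϑ t (z t) (deriv z t))) atTop (𝓝 (P.costVar z h t)) := by
  filter_upwards [h2.2.1, ae_deriv_add_smul hz hh] with t ht hd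
  have := tendsto_smul_sub (ht.differentiableAt one_ne_zero).hasFDerivAt (h t, deriv h t)
  rw [fderiv_cost_apply ht] at this
  simpa [hd, costVar] using! this

/-- The Lipschitz condition along curves bounds the difference quotients of the running cost, and
with them their limit, which is measurable although nothing is assumed on the partial gradients.
The measurability and the bound of the quotients hold for large `k` only, where the varied curve
is close to `z`. -/
theorem exists_costVar_bound (hz : z ∈ P.X) (h2 : P.H2 z) :
    ∃ L ≥ 0, ∀ h : ℝ → E n, ContDiff ℝ ∞ h →
      AEStronglyMeasurable (P.costVar z h) (leb P.T) ∧
      (∀ᶠ k : ℕ in atTop, AEStronglyMeasurable (fun t => ((k : ℝ) + 1) *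
        (P.ϑ t ((z + ((k : ℝ) + 1)⁻¹ • h) t) (deriv (z + ((k : ℝ) + 1)⁻¹ • h) t) -
          P.ϑ t (z t) (deriv z t))) (leb P.T)) ∧
      (∀ᶠ k : ℕ in atTop, ∀ᵐ t ∂leb P.T, ‖((k : ℝ) + 1) *
        (P.ϑ t ((z + ((k : ℝ) + 1)⁻¹ • h) t) (deriv (z + ((k : ℝ) + 1)⁻¹ • h) t) -
          P.ϑ t (z t) (deriv z t))‖ ≤ L * (‖h t‖ + ‖deriv h t‖)) ∧
      ∀ᵐ t ∂leb P.T, ‖P.costVar z h t‖ ≤ L * (‖h t‖ + ‖deriv h t‖) := by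
  have hlim := fun h hh => tendsto_cost_quotient hz h2 (h := h) hh
  obtain ⟨-, -, ε, hε, hmeas, L, hL⟩ := h2
  have hzz : acNorm P.T (z - z) ≤ ε := by simpa [acNorm] using hε.le
  refine ⟨|L|, abs_nonneg L, fun h hh => ?_⟩
  have hm : ∀ᶠ k : ℕ in atTop, AEStronglyMeasurable (fun t => ((k : ℝ) + 1) *
      (P.ϑ t ((z + ((k : ℝ) + 1)⁻¹ • h) t) (deriv (z + ((k : ℝ) + 1)⁻¹ • h) t) -
        P.ϑ t (z t) (deriv z t))) (leb P.T) := by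
    filter_upwards [eventually_acNorm_lt (P := P) (z := z) h hε] with k hk
    exact (((hmeas _ (add_smul_mem_X hz hh _) hk.le).sub (hmeas z hz hzz)).const_mul
      _).aestronglyMeasurable
  have hb : ∀ᶠ k : ℕ in atTop, ∀ᵐ t ∂leb P.T, ‖((k : ℝ) + 1) *
      (P.ϑ t ((z + ((k : ℝ) + 1)⁻¹ • h) t) (deriv (z + ((k : ℝ) + 1)⁻¹ • h) t) -
        P.ϑ t (z t) (deriv z t))‖ ≤ |L| * (‖h t‖ + ‖deriv h t‖) := by
    filter_upwards [eventually_acNorm_lt (P := P) (z := z) h hε] with k hk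
    filter_upwards [hL _ (add_smul_mem_X hz hh _) z hz hk.le hzz, ae_deriv_add_smul hz hh]
      with t ht hd
    have hk : (0 : ℝ) < (k : ℝ) + 1 := by positivity
    rw [norm_mul, Real.norm_eq_abs, Real.norm_eq_abs, abs_of_pos hk, ← le_div_iff₀' hk]
    refine ht.trans ((mul_le_mul_of_nonneg_right (le_abs_self L) (by positivity)).trans_eq ?_)
    rw [hd]
    simp only [Pi.add_apply, Pi.smul_apply, add_sub_cancel_left, norm_smul, norm_inv,
      Real.norm_eq_abs, abs_of_pos hk]
    field_simp
  refine ⟨?_, hm, hb, ?_⟩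
  · obtain ⟨k₀, hk₀⟩ := eventually_atTop.1 hm
    refine aestronglyMeasurable_of_tendsto_ae atTop (fun k : ℕ => hk₀ (k + k₀) (by omega)) ?_
    filter_upwards [hlim h hh] with t ht using ht.comp (tendsto_add_atTop_nat k₀)
  · obtain ⟨k₀, hk₀⟩ := eventually_atTop.1 hb
    have hall := ae_all_iff.2 fun k : ℕ => hk₀ (k + k₀) (by omega)
    filter_upwards [hlim h hh, hall] with t ht hbt
    exact le_of_tendsto' (ht.comp (tendsto_add_atTop_nat k₀)).norm hbt

theorem memLp_of_inner_bounded {F : ℝ → E n} {C T : ℝ}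
    (hm : ∀ i, AEStronglyMeasurable (fun t => inner ℝ (F t) (EuclideanSpace.single i (1 : ℝ)))
      (leb T))
    (hb : ∀ i, ∀ᵐ t ∂leb T, ‖inner ℝ (F t) (EuclideanSpace.single i (1 : ℝ))‖ ≤ C) :
    MemLp F 2 (leb T) := by
  apply MemLp.of_eval_piLp
  intro i
  have := MemLp.of_bound (p := 2) (hm i) C (hb i)
  simpa [EuclideanSpace.inner_single_right] using this

/-- Constant and linear variations show the partial gradients of the running cost along `z` to be
measurable and bounded. -/
theorem memLp_grad (hz : z ∈ P.X) (h2 : P.H2 z) :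
    MemLp (P.gradX z) 2 (leb P.T) ∧ MemLp (P.gradV z) 2 (leb P.T) := by
  obtain ⟨L, hL, H⟩ := exists_costVar_bound hz h2
  -- the partial gradients are read off from constant and from linear variations
  have hX : ∀ i : Fin n, P.costVar z (fun _ => EuclideanSpace.single i (1 : ℝ)) =
      fun t => inner ℝ (P.gradX z t) (EuclideanSpace.single i (1 : ℝ)) := by
    intro i; ext t; simp [costVar]
  have hV : ∀ i : Fin n, ∀ t, inner ℝ (P.gradV z t) (EuclideanSpace.single i (1 : ℝ)) =
      P.costVar z (fun s => s • EuclideanSpace.single i (1 : ℝ)) t -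
        t * P.costVar z (fun _ => EuclideanSpace.single i (1 : ℝ)) t := by
    intro i t
    have hd : deriv (fun s : ℝ => s • (EuclideanSpace.single i (1 : ℝ) : E n)) t =
        EuclideanSpace.single i (1 : ℝ) := by
      simpa using ((hasDerivAt_id t).smul_const (EuclideanSpace.single i (1 : ℝ) : E n)).deriv
    simp only [costVar, hd, deriv_const, inner_zero_right, inner_smul_right]
    ring
  have hsX : ∀ i : Fin n, ContDiff ℝ ∞ (fun _ : ℝ => (EuclideanSpace.single i (1 : ℝ) : E n)) :=
    fun i => contDiff_const
  have hsV : ∀ i : Fin n, ContDiff ℝ ∞ (fun s : ℝ => s • (EuclideanSpace.single i (1 : ℝ) : E n)) :=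
    fun i => contDiff_id.smul contDiff_const
  have hbX : ∀ i : Fin n, ∀ᵐ t ∂leb P.T,
      ‖P.costVar z (fun _ => EuclideanSpace.single i (1 : ℝ)) t‖ ≤ L := by
    intro i
    filter_upwards [(H _ (hsX i)).2.2.2] with t ht
    simpa using ht
  constructor
  · refine memLp_of_inner_bounded (C := L) (fun i => ?_) fun i => ?_
    · simpa [hX] using (H _ (hsX i)).1
    · simpa [hX] using hbX i
  · refine memLp_of_inner_bounded (C := L * (P.T + 1) + P.T * L) (fun i => ?_) fun i => ?_
    · simp only [hV]
      exact (H _ (hsV i)).1.sub (aestronglyMeasurable_id.mul (H _ (hsX i)).1)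
    · filter_upwards [(H _ (hsV i)).2.2.2, hbX i, ae_restrict_mem measurableSet_Icc]
        with t h1 h2 hm
      rw [hV]
      have hd : deriv (fun s : ℝ => s • (EuclideanSpace.single i (1 : ℝ) : E n)) t =
          EuclideanSpace.single i (1 : ℝ) := by
        simpa using ((hasDerivAt_id t).smul_const (EuclideanSpace.single i (1 : ℝ) : E n)).deriv
      rw [hd, norm_smul, PiLp.norm_single, norm_one, mul_one, Real.norm_eq_abs,
        Real.norm_eq_abs, abs_of_nonneg hm.1] at h1
      refine (norm_sub_le _ _).trans (add_le_add (h1.trans ?_) ?_)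
      · gcongr; exact hm.2
      · rw [norm_mul, Real.norm_eq_abs, abs_of_nonneg hm.1]
        exact mul_le_mul hm.2 h2 (norm_nonneg _) P.T_pos.le

theorem tendsto_integral_cost (hz : z ∈ P.X) (h2 : P.H2 z) {h : ℝ → E n}
    (hh : ContDiff ℝ ∞ h) :
    Tendsto (fun k : ℕ => ∫ t, ((k : ℝ) + 1) *
      (P.ϑ t ((z + ((k : ℝ) + 1)⁻¹ • h) t) (deriv (z + ((k : ℝ) + 1)⁻¹ • h) t) -
        P.ϑ t (z t) (deriv z t)) ∂leb P.T) atTop (𝓝 (∫ t, P.costVar z h t ∂leb P.T)) := by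
  obtain ⟨L, -, H⟩ := exists_costVar_bound hz h2
  obtain ⟨-, hm, hb, -⟩ := H h hh
  refine tendsto_integral_filter_of_dominated_convergence
    (fun t => L * (‖h t‖ + ‖deriv h t‖)) hm hb ?_ (tendsto_cost_quotient hz h2 hh)
  have hac := P.ac (mem_X_of_contDiff hh)
  refine Integrable.const_mul (Integrable.add ?_ (ac_integrable_deriv_leb P.T_pos.le hac).norm) L
  exact (hh.continuous.integrableOn_Icc).norm

/-- The distance from the velocity constraint has the expected first-order expansion. -/
theorem tendsto_integral_infDist (hz : z ∈ P.feasible) (h3 : Convex ℝ P.Ω₁) (h4 : P.H4 z)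
    {h : ℝ → E n} (hh : ContDiff ℝ ∞ h) :
    Tendsto (fun k : ℕ => ∫ t, ((k : ℝ) + 1) *
      Metric.infDist (deriv (z + ((k : ℝ) + 1)⁻¹ • h) t + P.g t ((z + ((k : ℝ) + 1)⁻¹ • h) t))
        P.Ω₁ ∂leb P.T) atTop
      (𝓝 (∫ t, Metric.infDist (P.linVel z h t) (P.velCone z t) ∂leb P.T)) := by
  have hT := P.T_pos.le
  have hzac := P.ac hz.1
  have hhac := P.ac (mem_X_of_contDiff (P := P) hh)
  obtain ⟨ε, hε, M, hM, hmeas, -, hdiff, -, hlip⟩ :=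
    exists_tube h4 (ac_aestronglyMeasurable hT hzac)
  have hclose : ∀ᶠ k : ℕ in atTop, ∀ᵐ t ∂leb P.T, ‖(z + ((k : ℝ) + 1)⁻¹ • h) t - z t‖ ≤ ε := by
    filter_upwards [eventually_acNorm_lt (P := P) (z := z) h hε] with k hk
    filter_upwards [ae_restrict_mem measurableSet_Icc] with t ht
    exact (norm_le_acNorm ((P.ac (add_smul_mem_X hz.1 hh _)).sub hzac) ht).trans hk.le
  refine tendsto_integral_filter_of_dominated_convergence
    (fun t => ‖deriv h t‖ + M * ‖h t‖) ?_ ?_ ?_ ?_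
  · filter_upwards [hclose] with k hk
    have hx := P.ac (add_smul_mem_X hz.1 hh ((k : ℝ) + 1)⁻¹)
    exact ((Metric.continuous_infDist_pt _).comp_aestronglyMeasurable
      ((ac_integrable_deriv_leb hT hx).1.add
        (hmeas _ (ac_aestronglyMeasurable hT hx) hk))).const_mul _
  · filter_upwards [hclose] with k hk
    filter_upwards [hk, hlip, hz.2.1, ae_deriv_add_smul hz.1 hh] with t h1 h2 h3 hd
    have hk : (0 : ℝ) < (k : ℝ) + 1 := by positivity
    rw [Real.norm_of_nonneg (mul_nonneg hk.le Metric.infDist_nonneg), ← le_div_iff₀' hk]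
    refine (Metric.infDist_le_dist_of_mem h3).trans ((dist_add_add_le _ _ _ _).trans ?_)
    rw [dist_eq_norm, dist_eq_norm, hd]
    refine (add_le_add_right (h2 _ h1) _).trans_eq ?_
    simp only [Pi.add_apply, Pi.smul_apply, add_sub_cancel_left, norm_smul, norm_inv,
      Real.norm_eq_abs, abs_of_pos hk]
    field_simp
  · exact (ac_integrable_deriv_leb hT hhac).norm.add
      (Integrable.const_mul (hh.continuous.integrableOn_Icc).norm M)
  · filter_upwards [hdiff, hz.2.1, ae_deriv_add_smul hz.1 hh] with t h1 h2 hd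
    refine tendsto_mul_infDist h3 h2 ?_
    have hg := tendsto_smul_sub h1.hasFDerivAt (h t)
    refine (hg.const_add (deriv h t)).congr fun k => ?_
    have hk : ((k : ℝ) + 1) ≠ 0 := by positivity
    rw [hd]
    simp only [Pi.add_apply, Pi.smul_apply, smul_sub, smul_add, smul_inv_smul₀ hk]
    abel

theorem endpoints_add_smul (z h : ℝ → E n) (T c : ℝ) :
    endpoints T (z + c • h) = endpoints T z + c • endpoints T h := rfl

/-- First-order necessary condition for the penalized problem along smooth variations. -/
theorem exists_variational_inequality (hmin : P.IsStrongLocalMin z) (h1 : P.H1 z) (h2 : P.H2 z)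
    (h3 : P.H3 z) (h4 : P.H4 z) (h5 : P.H5 z) :
    ∃ K ≥ 0, ∀ h : ℝ → E n, ContDiff ℝ ∞ h →
      0 ≤ inner ℝ (∇ P.φ (endpoints P.T z)) (endpoints P.T h) +
        ∫ t, P.costVar z h t ∂leb P.T +
        (K * (∫ t, Metric.infDist (P.linVel z h t) (P.velCone z t) ∂leb P.T) +
          K * Metric.infDist (endpoints P.T h) (feasibleCone P.Ω₂ (endpoints P.T z))) := by
  have hT := P.T_pos.le
  obtain ⟨δ, hδ, K, hK, H⟩ := exists_exact_penalty hmin h1 h2 h5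
  have hz := hmin.1
  refine ⟨K, hK, fun h hh => ?_⟩
  have hφ := tendsto_smul_sub (h1.differentiableAt one_ne_zero).hasFDerivAt (endpoints P.T h)
  have hφ' : fderiv ℝ P.φ (endpoints P.T z) (endpoints P.T h) =
      inner ℝ (∇ P.φ (endpoints P.T z)) (endpoints P.T h) := by
    rw [gradient, InnerProductSpace.toDual_symm_apply]
  rw [hφ'] at hφ
  have hϑ := tendsto_integral_cost hz.1 h2 hh
  have hd1 := tendsto_integral_infDist hz h3.1 h4 hh
  have hd2 : Tendsto (fun k : ℕ => ((k : ℝ) + 1) *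
      Metric.infDist (endpoints P.T (z + ((k : ℝ) + 1)⁻¹ • h)) P.Ω₂) atTop
      (𝓝 (Metric.infDist (endpoints P.T h) (feasibleCone P.Ω₂ (endpoints P.T z)))) := by
    refine tendsto_mul_infDist h3.2.1 hz.2.2.1 (tendsto_const_nhds.congr fun k => ?_)
    have hk : ((k : ℝ) + 1) ≠ 0 := by positivity
    rw [endpoints_add_smul, add_sub_cancel_left, smul_inv_smul₀ hk]
  refine ge_of_tendsto ((hφ.add hϑ).add ((hd1.const_mul K).add (hd2.const_mul K))) ?_
  filter_upwards [eventually_acNorm_lt (P := P) (z := z) h hδ] with k hk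
  obtain ⟨hint, hle⟩ := H _ (add_smul_mem_X hz.1 hh _) hk
  have hk : (0 : ℝ) < (k : ℝ) + 1 := by positivity
  rw [integral_const_mul, integral_const_mul,
    integral_sub hint ((intervalIntegrable_leb hT).1 hz.2.2.2), ← endpoints_add_smul, smul_eq_mul]
  rw [J, J, integral_leb hT, integral_leb hT] at hle
  refine (mul_nonneg hk.le hle).trans_eq ?_
  ring

/-- The cones depend on `t`, but distances from them are limits of distances from the fixed set
`Ω₁`. -/
theorem aestronglyMeasurable_infDist_velCone (hz : z ∈ P.feasible) (h3 : Convex ℝ P.Ω₁)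
    (h4 : P.H4 z) {f : ℝ → E n} (hf : AEStronglyMeasurable f (leb P.T)) :
    AEStronglyMeasurable (fun t => Metric.infDist (f t) (P.velCone z t)) (leb P.T) := by
  have hT := P.T_pos.le
  have hzac := P.ac hz.1
  obtain ⟨ε, hε, M, hM, hmeas, -⟩ := exists_tube h4 (ac_aestronglyMeasurable hT hzac)
  have hv : AEStronglyMeasurable (fun t => deriv z t + P.g t (z t)) (leb P.T) :=
    (ac_integrable_deriv_leb hT hzac).1.add
      (hmeas z (ac_aestronglyMeasurable hT hzac) (ae_of_all _ fun t => by simpa using hε.le))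
  have hm : ∀ k : ℕ, AEStronglyMeasurable (fun t => ((k : ℝ) + 1) *
      Metric.infDist (deriv z t + P.g t (z t) + ((k : ℝ) + 1)⁻¹ • f t) P.Ω₁) (leb P.T) := fun k =>
    ((Metric.continuous_infDist_pt P.Ω₁).comp_aestronglyMeasurable
      (hv.add (hf.const_smul ((k : ℝ) + 1)⁻¹))).const_mul _
  refine aestronglyMeasurable_of_tendsto_ae atTop hm ?_
  filter_upwards [hz.2.1] with t ht
  have hu : Tendsto (fun k : ℕ => ((k : ℝ) + 1) • (deriv z t + P.g t (z t) +
      ((k : ℝ) + 1)⁻¹ • f t - (deriv z t + P.g t (z t)))) atTop (𝓝 (f t)) := by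
    refine tendsto_const_nhds.congr fun k => ?_
    have hk : ((k : ℝ) + 1) ≠ 0 := by positivity
    rw [add_sub_cancel_left, smul_inv_smul₀ hk]
  exact tendsto_mul_infDist h3 ht hu

end Problem

/-! ### Multipliers from the Hahn–Banach theorem -/

/-- If `ℓ + N ∘ L` is nonnegative, with `N` sublinear, then `N` dominates a linear functional `ξ`
with `ℓ + ξ ∘ L = 0`. -/
theorem exists_multiplier_of_sublinear {V W : Type*} [AddCommGroup V] [Module ℝ V]
    [AddCommGroup W] [Module ℝ W] (ℓ : V →ₗ[ℝ] ℝ) (L : V →ₗ[ℝ] W) (N : W → ℝ)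
    (N_hom : ∀ c : ℝ, 0 < c → ∀ w, N (c • w) = c * N w)
    (N_add : ∀ v w, N (v + w) ≤ N v + N w) (h : ∀ v, 0 ≤ ℓ v + N (L v)) :
    ∃ ξ : W →ₗ[ℝ] ℝ, (∀ w, ξ w ≤ N w) ∧ ∀ v, ℓ v + ξ (L v) = 0 := by
  have N0 : N 0 = 0 := by
    have := N_hom 2 two_pos 0
    rw [smul_zero] at this
    linarith
  -- extend `-ℓ` from the graph of `L`; the extension vanishes on `V × 0`
  obtain ⟨G, hG, hGN⟩ := exists_extension_of_le_sublinear
    (⟨L.graph, -(ℓ ∘ₗ LinearMap.fst ℝ V W ∘ₗ L.graph.subtype)⟩ : (V × W) →ₗ.[ℝ] ℝ)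
    (fun p => N p.2) (fun c hc p => N_hom c hc p.2) (fun p q => N_add p.2 q.2) (by
      rintro ⟨⟨v, w⟩, hvw⟩
      have hw : w = L v := hvw
      subst hw
      have := h v
      change -ℓ v ≤ N (L v)
      linarith)
  have hG' : ∀ v, G (v, L v) = -ℓ v := fun v => hG ⟨(v, L v), rfl⟩
  have hG0 : ∀ v, G (v, 0) = 0 := by
    intro v
    have h1 := hGN (v, 0)
    have h2 := hGN (-(v, 0))
    rw [map_neg] at h2
    simp only [Prod.snd_neg, neg_zero, N0] at h1 h2
    linarith
  refine ⟨G ∘ₗ LinearMap.inr ℝ V W, fun w => hGN (0, w), fun v => ?_⟩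
  have : (v, L v) = (v, 0) + (0, L v) := by simp
  have h1 := hG' v
  rw [this, map_add, hG0] at h1
  simp only [LinearMap.comp_apply, LinearMap.inr_apply]
  linarith

section SquareIntegrable

variable {n : ℕ} {T : ℝ}

theorem memLp_inner_integrable {f g : ℝ → E n} (hf : MemLp f 2 (leb T)) (hg : MemLp g 2 (leb T)) :
    Integrable (fun t => inner ℝ (f t) (g t)) (leb T) := by
  refine (L2.integrable_inner (𝕜 := ℝ) (hf.toLp f) (hg.toLp g)).congr ?_
  filter_upwards [hf.coeFn_toLp, hg.coeFn_toLp] with t h1 h2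
  rw [h1, h2]

theorem memLp_of_continuousOn {f : ℝ → E n} (hf : ContinuousOn f (Icc 0 T)) :
    MemLp f 2 (leb T) := by
  obtain ⟨C, hC⟩ := isCompact_Icc.exists_bound_of_continuousOn hf
  refine MemLp.of_bound (hf.aestronglyMeasurable measurableSet_Icc) C ?_
  filter_upwards [ae_restrict_mem measurableSet_Icc] with t ht using hC t ht

theorem memLp_clm_apply {A : ℝ → E n →L[ℝ] E n} {M : ℝ} (hA : AEStronglyMeasurable A (leb T))
    (hM : ∀ᵐ t ∂leb T, ‖A t‖ ≤ M) {f : ℝ → E n} (hf : MemLp f 2 (leb T)) :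
    MemLp (fun t => A t (f t)) 2 (leb T) := by
  refine hf.of_le_mul (c := M)
    (isBoundedBilinearMap_apply.continuous.comp_aestronglyMeasurable (hA.prodMk hf.1)) ?_
  filter_upwards [hM] with t ht
  exact (A t).le_of_opNorm_le ht _

theorem exists_integral_norm_le (n : ℕ) (T : ℝ) :
    ∃ C ≥ 0, ∀ f : Lp (E n) 2 (leb T), ∫ t, ‖f t‖ ∂leb T ≤ C * ‖f‖ := by
  refine ⟨(leb T univ ^ (1 / 2 : ℝ)).toReal, ENNReal.toReal_nonneg, fun f => ?_⟩
  have hf := (Lp.memLp f).1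
  have h := eLpNorm_le_eLpNorm_mul_rpow_measure_univ (μ := leb T) (p := 1) (q := 2)
    (by norm_num) hf
  rw [integral_norm_eq_lintegral_enorm hf, ← eLpNorm_one_eq_lintegral_enorm, Lp.norm_def, mul_comm,
    ← ENNReal.toReal_mul]
  have he : (1 / (1 : ENNReal).toReal - 1 / (2 : ENNReal).toReal) = (1 / 2 : ℝ) := by norm_num
  rw [he] at h
  refine ENNReal.toReal_mono (ENNReal.mul_ne_top (Lp.eLpNorm_ne_top f) ?_) h
  exact ENNReal.rpow_ne_top_of_nonneg (by norm_num) (measure_ne_top _ _)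

end SquareIntegrable

/-- A linear functional below a multiple of the norm is an inner product. -/
theorem exists_inner_of_le_norm {H : Type*} [NormedAddCommGroup H] [InnerProductSpace ℝ H]
    [CompleteSpace H] (ξ : H →ₗ[ℝ] ℝ) (C : ℝ) (h : ∀ x, ξ x ≤ C * ‖x‖) :
    ∃ q : H, ∀ x, ξ x = inner ℝ q x := by
  refine ⟨(InnerProductSpace.toDual ℝ H).symm (ξ.mkContinuous C fun x => ?_), fun x => ?_⟩
  · have h' := h (-x)
    rw [map_neg, norm_neg] at h'
    exact abs_le.2 ⟨by linarith, h x⟩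
  · rw [InnerProductSpace.toDual_symm_apply]
    rfl

/-- The space of smooth curves. -/
def smoothCurves (n : ℕ) : Submodule ℝ (ℝ → E n) where
  carrier := {h | ContDiff ℝ ∞ h}
  zero_mem' := show ContDiff ℝ ∞ (fun _ => (0 : E n)) from contDiff_const
  add_mem' := @fun x y (hx : ContDiff ℝ ∞ x) (hy : ContDiff ℝ ∞ y) => hx.add hy
  smul_mem' := fun c x (hx : ContDiff ℝ ∞ x) => show ContDiff ℝ ∞ (c • x) from hx.const_smul c

theorem smoothCurves_contDiff {n : ℕ} (h : smoothCurves n) : ContDiff ℝ ∞ (h : ℝ → E n) := h.2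

theorem smoothCurves_deriv {n : ℕ} (h : smoothCurves n) : Continuous (deriv (h : ℝ → E n)) :=
  (smoothCurves_contDiff h).continuous_deriv (by simp)

theorem smoothCurves_differentiableAt {n : ℕ} (h : smoothCurves n) (t : ℝ) :
    DifferentiableAt ℝ (h : ℝ → E n) t :=
  (smoothCurves_contDiff h).differentiable (by simp) t

theorem smoothCurves_deriv_add {n : ℕ} (x y : smoothCurves n) (t : ℝ) :
    deriv ((x : ℝ → E n) + (y : ℝ → E n)) t = deriv (x : ℝ → E n) t + deriv y t :=
  deriv_add (smoothCurves_differentiableAt x t) (smoothCurves_differentiableAt y t)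

theorem smoothCurves_deriv_smul {n : ℕ} (c : ℝ) (x : smoothCurves n) (t : ℝ) :
    deriv (c • (x : ℝ → E n)) t = c • deriv (x : ℝ → E n) t :=
  deriv_const_smul c (smoothCurves_differentiableAt x t)

namespace Problem

variable {n : ℕ} {P : Problem n} {z : ℝ → E n}

theorem integrable_costVar (hz : z ∈ P.X) (h2 : P.H2 z) (h : smoothCurves n) :
    Integrable (P.costVar z h) (leb P.T) :=
  (memLp_inner_integrable (memLp_grad hz h2).1
    (memLp_of_continuousOn (smoothCurves_contDiff h).continuous.continuousOn)).add
    (memLp_inner_integrable (memLp_grad hz h2).2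
      (memLp_of_continuousOn (smoothCurves_deriv h).continuousOn))

theorem memLp_linVel (hz : z ∈ P.X) (h4 : P.H4 z) (h : smoothCurves n) :
    MemLp (P.linVel z h) 2 (leb P.T) := by
  obtain ⟨-, -, M, -, -, hm, -, hM, -⟩ :=
    exists_tube h4 (ac_aestronglyMeasurable P.T_pos.le (P.ac hz))
  exact (memLp_of_continuousOn (smoothCurves_deriv h).continuousOn).add
    (memLp_clm_apply hm hM
      (memLp_of_continuousOn (smoothCurves_contDiff h).continuous.continuousOn))

theorem integrable_infDist_velCone (hz : z ∈ P.feasible) (h3 : Convex ℝ P.Ω₁) (h4 : P.H4 z)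
    {f : ℝ → E n} (hf : Integrable f (leb P.T)) :
    Integrable (fun t => Metric.infDist (f t) (P.velCone z t)) (leb P.T) := by
  refine hf.norm.mono' (aestronglyMeasurable_infDist_velCone hz h3 h4 hf.1) ?_
  filter_upwards [hz.2.1] with t ht
  rw [Real.norm_of_nonneg Metric.infDist_nonneg]
  exact infDist_feasibleCone_le_norm ht _

/-- A square integrable curve whose inner products are dominated in the mean by the distance from
the cones of feasible velocities is normal to `Ω₁` almost everywhere. -/
theorem ae_normal_of_integral_le (hz : z ∈ P.feasible) (h3 : Convex ℝ P.Ω₁) (h4 : P.H4 z)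
    (q : Lp (E n) 2 (leb P.T)) (K : ℝ)
    (hq : ∀ f : Lp (E n) 2 (leb P.T),
      inner ℝ q f ≤ K * ∫ t, Metric.infDist (f t) (P.velCone z t) ∂leb P.T) :
    ∀ᵐ t ∂leb P.T, ∀ w ∈ P.Ω₁, inner ℝ (q t) (w - (deriv z t + P.g t (z t))) ≤ 0 := by
  have key : ∀ w : E n, ∀ᵐ t ∂leb P.T, inner ℝ w (q t) ≤ K * Metric.infDist w (P.velCone z t) := by
    intro w
    have hwint := integrable_infDist_velCone hz h3 h4 (integrable_const (μ := leb P.T) w)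
    refine ae_le_of_forall_setIntegral_le ?_ (hwint.const_mul K) fun s hs hμs => ?_
    · exact memLp_inner_integrable (memLp_const w) (Lp.memLp q)
    · have h := hq (indicatorConstLp 2 hs hμs.ne w)
      rw [real_inner_comm, L2.inner_indicatorConstLp_eq_setIntegral_inner] at h
      refine h.trans_eq ?_
      rw [integral_const_mul, ← integral_indicator hs]
      congr 1
      refine integral_congr_ae ?_
      filter_upwards [indicatorConstLp_coeFn (p := 2) (hs := hs) (hμs := hμs.ne) (c := w), hz.2.1]
        with t ht ht'
      rw [ht]
      by_cases hts : t ∈ s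
      · simp [hts]
      · simp only [hts, not_false_eq_true, indicator_of_notMem]
        exact Metric.infDist_zero_of_mem (zero_mem_feasibleCone ht')
  have hall := ae_all_iff.2 fun j : ℕ => key (TopologicalSpace.denseSeq (E n) j)
  filter_upwards [hall] with t ht w hw
  have := (TopologicalSpace.denseRange_denseSeq (E n)).induction_on
    (p := fun w => inner ℝ w (q t) ≤ K * Metric.infDist w (P.velCone z t))
    (w - (deriv z t + P.g t (z t)))
    (isClosed_le (by fun_prop) ((Metric.continuous_infDist_pt _).const_mul K)) ht
  rwa [velCone, Metric.infDist_zero_of_mem (sub_mem_feasibleCone hw), mul_zero,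
    real_inner_comm] at this

theorem mem_normalCone_of_le {H : Type*} [NormedAddCommGroup H] [InnerProductSpace ℝ H]
    {Ω : Set H} {a e : H} {K : ℝ} (ha : a ∈ Ω)
    (h : ∀ w, inner ℝ e w ≤ K * Metric.infDist w (feasibleCone Ω a)) : e ∈ normalCone Ω a := by
  refine ⟨ha, fun w hw => ?_⟩
  have := h (w - a)
  rwa [Metric.infDist_zero_of_mem (sub_mem_feasibleCone hw), mul_zero] at this

/-- The Lagrange multipliers of the two constraints, in weak form. -/
theorem exists_multipliers (hmin : P.IsStrongLocalMin z) (h1 : P.H1 z) (h2 : P.H2 z)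
    (h3 : P.H3 z) (h4 : P.H4 z) (h5 : P.H5 z) :
    ∃ q : ℝ → E n, MemLp q 2 (leb P.T) ∧
      (∀ᵐ t ∂leb P.T, ∀ w ∈ P.Ω₁, inner ℝ (q t) (w - (deriv z t + P.g t (z t))) ≤ 0) ∧
      ∃ e ∈ normalCone P.Ω₂ (endpoints P.T z), ∀ h : ℝ → E n, ContDiff ℝ ∞ h →
        ∫ t, (P.costVar z h t + inner ℝ (q t) (P.linVel z h t)) ∂leb P.T +
          inner ℝ (∇ P.φ (endpoints P.T z) + e) (endpoints P.T h) = 0 := by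
  obtain ⟨K, hK, H⟩ := exists_variational_inequality hmin h1 h2 h3 h4 h5
  have hz := hmin.1
  let ℓ : smoothCurves n →ₗ[ℝ] ℝ :=
    { toFun := fun h => inner ℝ (∇ P.φ (endpoints P.T z)) (endpoints P.T h) +
        ∫ t, P.costVar z h t ∂leb P.T
      map_add' := by
        intro x y
        have he : endpoints P.T ((x + y : smoothCurves n) : ℝ → E n) =
          endpoints P.T x + endpoints P.T y := rfl
        have hc : P.costVar z ((x + y : smoothCurves n) : ℝ → E n) =
            P.costVar z x + P.costVar z y := by
          ext t
          simp only [costVar, smoothCurves_deriv_add, Submodule.coe_add, Pi.add_apply,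
            inner_add_right]
          ring
        rw [he, hc, inner_add_right, integral_add' (integrable_costVar hz.1 h2 x)
          (integrable_costVar hz.1 h2 y)]
        ring
      map_smul' := by
        intro c x
        have he : endpoints P.T ((c • x : smoothCurves n) : ℝ → E n) = c • endpoints P.T x := rfl
        have hc : ∀ t, P.costVar z ((c • x : smoothCurves n) : ℝ → E n) t =
            c * P.costVar z x t := by
          intro t
          simp only [costVar, smoothCurves_deriv_smul, Submodule.coe_smul, Pi.smul_apply,
            inner_smul_right]
          ring
        simp only [he, hc, inner_smul_right, integral_const_mul, RingHom.id_apply, smul_eq_mul]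
        ring }
  let L : smoothCurves n →ₗ[ℝ] Lp (E n) 2 (leb P.T) × EP n :=
    { toFun := fun h => ((memLp_linVel hz.1 h4 h).toLp _, endpoints P.T h)
      map_add' := by
        intro x y
        refine Prod.ext ?_ rfl
        change (memLp_linVel hz.1 h4 (x + y)).toLp _ =
          (memLp_linVel hz.1 h4 x).toLp _ + (memLp_linVel hz.1 h4 y).toLp _
        rw [← MemLp.toLp_add]
        refine MemLp.toLp_congr _ ((memLp_linVel hz.1 h4 x).add (memLp_linVel hz.1 h4 y))
          (ae_of_all _ fun t => ?_)
        simp only [linVel, smoothCurves_deriv_add, Submodule.coe_add, Pi.add_apply, map_add]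
        abel
      map_smul' := by
        intro c x
        refine Prod.ext ?_ rfl
        change (memLp_linVel hz.1 h4 (c • x)).toLp _ = c • (memLp_linVel hz.1 h4 x).toLp _
        rw [← MemLp.toLp_const_smul]
        refine MemLp.toLp_congr _ ((memLp_linVel hz.1 h4 x).const_smul c)
          (ae_of_all _ fun t => ?_)
        simp only [linVel, smoothCurves_deriv_smul, Submodule.coe_smul, Pi.smul_apply, map_smul,
          smul_add] }
  let N : Lp (E n) 2 (leb P.T) × EP n → ℝ := fun p =>
    K * (∫ t, Metric.infDist (p.1 t) (P.velCone z t) ∂leb P.T) +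
      K * Metric.infDist p.2 (feasibleCone P.Ω₂ (endpoints P.T z))
  have hLint : ∀ f : Lp (E n) 2 (leb P.T), Integrable f (leb P.T) := fun f =>
    (Lp.memLp f).integrable (by norm_num)
  have hNint := fun f : Lp (E n) 2 (leb P.T) => integrable_infDist_velCone hz h3.1 h4 (hLint f)
  obtain ⟨ξ, hξN, hξ⟩ := exists_multiplier_of_sublinear ℓ L N (by
      rintro c hc ⟨f, e⟩
      have : ∫ t, Metric.infDist ((c • f : Lp (E n) 2 (leb P.T)) t) (P.velCone z t) ∂leb P.T =
          c * ∫ t, Metric.infDist (f t) (P.velCone z t) ∂leb P.T := by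
        rw [← integral_const_mul]
        refine integral_congr_ae ?_
        filter_upwards [Lp.coeFn_smul c f, hz.2.1] with t ht ht'
        rw [ht, Pi.smul_apply]
        exact infDist_feasibleCone_smul ht' hc _
      simp only [N, Prod.smul_mk, this, infDist_feasibleCone_smul hz.2.2.1 hc]
      ring) (by
      rintro ⟨f, e⟩ ⟨f', e'⟩
      have h1 : ∫ t, Metric.infDist ((f + f' : Lp (E n) 2 (leb P.T)) t) (P.velCone z t) ∂leb P.T ≤
          ∫ t, Metric.infDist (f t) (P.velCone z t) ∂leb P.T +
            ∫ t, Metric.infDist (f' t) (P.velCone z t) ∂leb P.T := by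
        rw [← integral_add (hNint f) (hNint f')]
        refine integral_mono_ae (hNint _) ((hNint f).add (hNint f')) ?_
        filter_upwards [Lp.coeFn_add f f', hz.2.1] with t ht ht'
        rw [ht, Pi.add_apply]
        exact infDist_feasibleCone_add_le h3.1 ht' _ _
      have h2 := infDist_feasibleCone_add_le h3.2.1 hz.2.2.1 e e'
      simp only [N, Prod.mk_add_mk]
      have := mul_le_mul_of_nonneg_left h1 hK
      have := mul_le_mul_of_nonneg_left h2 hK
      linarith) (by
      intro h
      refine (H h (smoothCurves_contDiff h)).trans_eq ?_
      have : ∫ t, Metric.infDist ((L h).1 t) (P.velCone z t) ∂leb P.T =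
          ∫ t, Metric.infDist (P.linVel z h t) (P.velCone z t) ∂leb P.T := by
        refine integral_congr_ae ?_
        filter_upwards [(memLp_linVel hz.1 h4 h).coeFn_toLp] with t ht
        exact congrArg (fun w => Metric.infDist w (P.velCone z t)) ht
      simp only [N, this]
      rfl)
  have h0 : ∫ t, Metric.infDist ((0 : Lp (E n) 2 (leb P.T)) t) (P.velCone z t) ∂leb P.T = 0 := by
    refine integral_eq_zero_of_ae ?_
    filter_upwards [Lp.coeFn_zero (E n) 2 (leb P.T), hz.2.1] with t ht ht'
    rw [ht]
    exact Metric.infDist_zero_of_mem (zero_mem_feasibleCone ht')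
  have hξ1 : ∀ f, ξ (f, 0) ≤ K * ∫ t, Metric.infDist (f t) (P.velCone z t) ∂leb P.T := by
    intro f
    refine (hξN (f, 0)).trans_eq ?_
    simp only [N]
    rw [Metric.infDist_zero_of_mem (zero_mem_feasibleCone hz.2.2.1), mul_zero, add_zero]
  have hξ2 : ∀ e, ξ (0, e) ≤ K * Metric.infDist e (feasibleCone P.Ω₂ (endpoints P.T z)) := by
    intro e
    refine (hξN (0, e)).trans_eq ?_
    simp only [N]
    rw [h0, mul_zero, zero_add]
  obtain ⟨C, hC, hCn⟩ := exists_integral_norm_le n P.T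
  obtain ⟨q, hq⟩ := exists_inner_of_le_norm (ξ ∘ₗ LinearMap.inl ℝ _ _) (K * C) fun f => by
    refine (hξ1 f).trans ?_
    rw [mul_assoc]
    refine mul_le_mul_of_nonneg_left (le_trans ?_ (hCn f)) hK
    refine integral_mono_ae (hNint f) (hLint f).norm ?_
    filter_upwards [hz.2.1] with t ht using infDist_feasibleCone_le_norm ht _
  obtain ⟨e, he⟩ := exists_inner_of_le_norm (ξ ∘ₗ LinearMap.inr ℝ _ _) K fun e =>
    (hξ2 e).trans (mul_le_mul_of_nonneg_left (infDist_feasibleCone_le_norm hz.2.2.1 _) hK)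
  refine ⟨q, Lp.memLp q, ?_, e, ?_, fun h hh => ?_⟩
  · exact ae_normal_of_integral_le hz h3.1 h4 q K fun f => (hq f).symm.trans_le (hξ1 f)
  · exact mem_normalCone_of_le hz.2.2.1 fun w => (he w).symm.trans_le (hξ2 w)
  · have hs := hξ ⟨h, hh⟩
    have hsplit : L ⟨h, hh⟩ = ((L ⟨h, hh⟩).1, 0) + (0, endpoints P.T h) := by
      refine Prod.ext ?_ ?_
      · simp
      · simp [L]
    have e1 : ξ ((L ⟨h, hh⟩).1, 0) = ∫ t, inner ℝ (q t) (P.linVel z h t) ∂leb P.T := by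
      refine (hq _).trans ?_
      rw [L2.inner_def]
      refine integral_congr_ae ?_
      filter_upwards [(memLp_linVel hz.1 h4 ⟨h, hh⟩).coeFn_toLp] with t ht
      exact congrArg (inner ℝ (q t)) ht
    have e2 : ξ (0, endpoints P.T h) = inner ℝ e (endpoints P.T h) := he _
    rw [hsplit, map_add, e1, e2] at hs
    rw [integral_add (integrable_costVar hz.1 h2 ⟨h, hh⟩)
      (memLp_inner_integrable (Lp.memLp q) (memLp_linVel hz.1 h4 ⟨h, hh⟩)), inner_add_left]
    change inner ℝ (∇ P.φ (endpoints P.T z)) (endpoints P.T h) +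
      ∫ t, P.costVar z h t ∂leb P.T + _ = 0 at hs
    linarith

end Problem

/-! ### The fundamental lemma of the calculus of variations -/

/-- Smooth test functions are derivatives of smooth curves. -/
theorem exists_contDiff_primitive {n : ℕ} {u : ℝ → ℝ} (hu : ContDiff ℝ ∞ u) (v : E n) :
    ∃ h : ℝ → E n, ContDiff ℝ ∞ h ∧ ∀ t, deriv h t = u t • v := by
  have hd : ∀ t, HasDerivAt (fun t => (∫ s in (0 : ℝ)..t, u s) • v) (u t • v) t := fun t =>
    (intervalIntegral.integral_hasDerivAt_right (hu.continuous.intervalIntegrable _ _)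
      hu.continuous.stronglyMeasurable.stronglyMeasurableAtFilter
      hu.continuous.continuousAt).smul_const v
  refine ⟨_, contDiff_infty_iff_deriv.2 ⟨fun t => (hd t).differentiableAt, ?_⟩,
    fun t => (hd t).deriv⟩
  rw [funext fun t => (hd t).deriv]
  exact hu.smul contDiff_const

/-- The lemma of du Bois-Reymond, with natural boundary conditions. -/
theorem du_bois_reymond {n : ℕ} {T : ℝ} (hT : 0 ≤ T) {r s : ℝ → E n} (hr : MemLp r 2 (leb T))
    (hs : MemLp s 2 (leb T)) {α β : E n}
    (H : ∀ h : ℝ → E n, ContDiff ℝ ∞ h →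
      ∫ t, (inner ℝ (r t) (h t) + inner ℝ (s t) (deriv h t)) ∂leb T +
        (inner ℝ α (h 0) + inner ℝ β (h T)) = 0) :
    ∃ p : ℝ → E n, AbsolutelyContinuousOnInterval p 0 T ∧ p 0 = α ∧ p T = -β ∧
      (∀ᵐ t ∂leb T, deriv p t = r t) ∧ ∀ᵐ t ∂leb T, p t = s t := by
  have hrint : IntervalIntegrable r volume 0 T :=
    (intervalIntegrable_leb hT).2 (hr.integrable (by norm_num))
  set p : ℝ → E n := fun t => α + ∫ τ in (0 : ℝ)..t, r τ
  have hconst : AbsolutelyContinuousOnInterval (fun _ : ℝ => α) 0 T :=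
    (LipschitzWith.const α).lipschitzOnWith.absolutelyContinuousOnInterval
  have hp : AbsolutelyContinuousOnInterval p 0 T := hconst.add (ac_integral hrint)
  have hp0 : p 0 = α := by simp [p]
  have hdp : ∀ᵐ t ∂leb T, deriv p t = r t := by
    filter_upwards [ae_restrict_of_ae hrint.ae_hasDerivAt_integral,
      ae_restrict_mem measurableSet_Icc] with t ht hm
    rw [uIcc_of_le hT] at ht
    exact ((ht hm 0 (left_mem_Icc.2 hT)).const_add α).deriv
  have hpL : MemLp p 2 (leb T) := memLp_of_continuousOn (by
    simpa [uIcc_of_le hT] using hp.continuousOn)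
  have H' : ∀ h : ℝ → E n, ContDiff ℝ ∞ h →
      ∫ t, inner ℝ (s t - p t) (deriv h t) ∂leb T + inner ℝ (β + p T) (h T) = 0 := by
    intro h hh
    have hhac : AbsolutelyContinuousOnInterval h 0 T :=
      (hh.of_le (by simp)).contDiffOn.absolutelyContinuousOnInterval
    have hL : MemLp h 2 (leb T) := memLp_of_continuousOn hh.continuous.continuousOn
    have hdL : MemLp (deriv h) 2 (leb T) :=
      memLp_of_continuousOn (hh.continuous_deriv (by simp)).continuousOn
    have hparts : ∫ t, (inner ℝ (p t) (deriv h t) + inner ℝ (r t) (h t)) ∂leb T =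
        inner ℝ (p T) (h T) - inner ℝ α (h 0) := by
      have hibp := ac_integral_inner_deriv hp hhac
      rw [integral_leb hT, hp0] at hibp
      rw [← hibp]
      refine integral_congr_ae ?_
      filter_upwards [hdp] with t ht
      rw [ht]
    have h0 := H h hh
    rw [integral_add (memLp_inner_integrable hpL hdL) (memLp_inner_integrable hr hL)] at hparts
    rw [integral_add (memLp_inner_integrable hr hL) (memLp_inner_integrable hs hdL)] at h0
    simp only [inner_sub_left]
    rw [integral_sub (memLp_inner_integrable hs hdL) (memLp_inner_integrable hpL hdL),
      inner_add_left]
    linarith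
  have hpT : β + p T = 0 := by
    have := H' (fun _ => β + p T) contDiff_const
    simpa using this
  refine ⟨p, hp, hp0, (neg_eq_of_add_eq_zero_right hpT).symm, hdp, ?_⟩
  have hsp : Integrable (fun t => s t - p t) (leb T) := (hs.sub hpL).integrable (by norm_num)
  have hzero := ae_eq_zero_of_integral_contDiff_smul_eq_zero (μ := leb T)
    (f := fun t => s t - p t) hsp.locallyIntegrable fun u hu hsupp => by
      refine ext_inner_right ℝ fun v => ?_
      obtain ⟨h, hh, hd⟩ := exists_contDiff_primitive hu v
      have hint : Integrable (fun t => u t • (s t - p t)) (leb T) := by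
        obtain ⟨C, hC⟩ := hsupp.exists_bound_of_continuous hu.continuous
        exact hsp.bdd_smul C hu.continuous.aestronglyMeasurable (ae_of_all _ hC)
      have := H' h hh
      rw [hpT, inner_zero_left, add_zero] at this
      rw [inner_zero_left, ← this, real_inner_comm, ← integral_inner hint]
      simp only [hd, inner_smul_right, real_inner_comm v]
  filter_upwards [hzero] with t ht
  exact (sub_eq_zero.1 ht).symm

namespace Problem

theorem memLp_adjG {n : ℕ} {P : Problem n} {z : ℝ → E n} (hz : z ∈ P.X) (h4 : P.H4 z)
    {q : ℝ → E n} (hq : MemLp q 2 (leb P.T)) : MemLp (fun t => P.adjG z t (q t)) 2 (leb P.T) := by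
  obtain ⟨-, -, M, -, -, hm, -, hM, -⟩ :=
    exists_tube h4 (ac_aestronglyMeasurable P.T_pos.le (P.ac hz))
  refine memLp_clm_apply (M := M)
    (ContinuousLinearMap.adjoint.continuous.comp_aestronglyMeasurable hm) ?_ hq
  filter_upwards [hM] with t ht
  exact (LinearIsometryEquiv.norm_map _ _).trans_le ht

end Problem

end ExtBolza

theorem theorem3p1 (n : ℕ) (P : ExtBolza.Problem n) (z : ℝ → ExtBolza.E n)
    (hmin : P.IsStrongLocalMin z)
    (h1 : P.H1 z) (h2 : P.H2 z) (h3 : P.H3 z) (h4 : P.H4 z) (h5 : P.H5 z) :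
    ∃ p : ℝ → ExtBolza.E n, AbsolutelyContinuousOnInterval p 0 P.T ∧
      P.EulerLagrange z p ∧ P.Maximization z p ∧ P.Transversality z p := by
  obtain ⟨q, hq, hqN, e, he, hweak⟩ := ExtBolza.Problem.exists_multipliers hmin h1 h2 h3 h4 h5
  have hz := hmin.1
  obtain ⟨hgX, hgV⟩ := ExtBolza.Problem.memLp_grad hz.1 h2
  set c := ∇ P.φ (ExtBolza.endpoints P.T z) + e with hc
  obtain ⟨p, hp, hp0, hpT, hdp, hps⟩ := ExtBolza.du_bois_reymond P.T_pos.le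
    (hgX.add (ExtBolza.Problem.memLp_adjG hz.1 h4 hq)) (hgV.add hq) (α := c.fst) (β := c.snd)
    fun h hh => by
      refine Eq.trans ?_ (hweak h hh)
      rw [WithLp.prod_inner_apply]
      refine congrArg₂ _ ?_ rfl
      refine integral_congr_ae (ae_of_all _ fun t => ?_)
      simp only [ExtBolza.Problem.costVar, ExtBolza.Problem.linVel, ExtBolza.Problem.adjG,
        Pi.add_apply, inner_add_left, inner_add_right, ContinuousLinearMap.adjoint_inner_left]
      ring
  refine ⟨p, hp, ?_, ?_, ?_⟩
  · filter_upwards [hdp, hps] with t h1 h2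
    rw [h1, h2]
    simp only [Pi.add_apply, map_add]
    abel
  · filter_upwards [hps, hqN, hz.2.1] with t h1 h2 h3
    have hpq : p t - P.gradV z t = q t := by simp [h1]
    refine ⟨⟨_, h3, rfl⟩, ?_⟩
    rintro _ ⟨w, hw, rfl⟩
    have := h2 w hw
    rw [inner_sub_right] at this
    simp only [hpq]
    linarith
  · refine ⟨_, rfl, e, he, ?_⟩
    rw [hp0, hpT, neg_neg]
    rfl
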